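/- A $4$-polytope is a $4$-dimensional polytope $P\subset\mathbb{R}^4$ (the convex hull of a finite set of points); it is \emph{$2$-simple $2$-simplicial} if all $2$-dimensional faces of $P$, and all $2$-dimensional faces of its dual polytope $P^*$ (the polar dual with respect to an interior point of $P$), are triangles. Two polytopes have the same combinatorial type if their face lattices are isomorphic. For $n\ge 0$ let $N(n)$ be the number of combinatorial types of $2$-simple $2$-simplicial $4$-polytopes with exactly $10+4n$ vertices. Then $N(n)$ is finite for every $n\ge0$, and it grows (at least) exponentially in $n$: there are constants $C>0$ and $c>1$ such that \[ N(n)\ \ge\ C\,c^{\,n}\qquad\text{for all integers } n\ge 0 . \] -/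

import Mathlib

namespace Polytopes

/-- A `d`-polytope in `ℝ^d`: the convex hull of a finite set of points, of dimension `d`
(that is, its affine hull is the whole space). -/
def IsPolytope {d : ℕ} (P : Set (EuclideanSpace ℝ (Fin d))) : Prop :=
  (∃ S : Set (EuclideanSpace ℝ (Fin d)), S.Finite ∧ P = convexHull ℝ S) ∧
    affineSpan ℝ P = ⊤

/-- The face lattice of `P`, ordered by inclusion. The faces of `P` are the empty set and the
sets of maximizers over `P` of a linear functional; the functional `0` gives `P` itself. -/
abbrev FaceLattice {d : ℕ} (P : Set (EuclideanSpace ℝ (Fin d))) : Type :=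
  {F : Set (EuclideanSpace ℝ (Fin d)) // IsExposed ℝ P F}

/-- `F` is a `2`-face of `P`: a face of dimension two. -/
def IsTwoFace {d : ℕ} (P F : Set (EuclideanSpace ℝ (Fin d))) : Prop :=
  IsExposed ℝ P F ∧ Module.finrank ℝ (vectorSpan ℝ F) = 2

/-- A triangle: the convex hull of three affinely independent points. -/
def IsTriangle {d : ℕ} (F : Set (EuclideanSpace ℝ (Fin d))) : Prop :=
  ∃ v : Fin 3 → EuclideanSpace ℝ (Fin d),
    AffineIndependent ℝ v ∧ F = convexHull ℝ (Set.range v)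

/-- The polar dual of `P` with respect to the point `p` (taken as the origin). -/
def polarDual {d : ℕ} (P : Set (EuclideanSpace ℝ (Fin d))) (p : EuclideanSpace ℝ (Fin d)) :
    Set (EuclideanSpace ℝ (Fin d)) :=
  {y | ∀ x ∈ P, inner ℝ (x - p) y ≤ 1}

/-- `P` is `2`-simplicial: all its `2`-faces are triangles. -/
def IsTwoSimplicial {d : ℕ} (P : Set (EuclideanSpace ℝ (Fin d))) : Prop :=
  ∀ F, IsTwoFace P F → IsTriangle F

/-- `P` is `2`-simple: its dual polytope is `2`-simplicial. The dual is the polar dual with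
respect to an interior point of `P`; its combinatorial type, and hence the property, does not
depend on the choice of the interior point. -/
def IsTwoSimple {d : ℕ} (P : Set (EuclideanSpace ℝ (Fin d))) : Prop :=
  ∃ p ∈ interior P, IsTwoSimplicial (polarDual P p)

/-- The `2`-simple `2`-simplicial `4`-polytopes in `ℝ^4` with exactly `m` vertices. -/
def TwoSTwoSPolytope (m : ℕ) : Type :=
  {P : Set (EuclideanSpace ℝ (Fin 4)) //
    IsPolytope P ∧ IsTwoSimple P ∧ IsTwoSimplicial P ∧ (P.extremePoints ℝ).encard = m}

/-- Combinatorial equivalence: the face lattices are isomorphic. -/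
def combEquiv (m : ℕ) : Setoid (TwoSTwoSPolytope m) where
  r P Q := Nonempty (FaceLattice P.1 ≃o FaceLattice Q.1)
  iseqv :=
    { refl := fun _ => ⟨OrderIso.refl _⟩
      symm := fun ⟨e⟩ => ⟨e.symm⟩
      trans := fun ⟨e⟩ ⟨f⟩ => ⟨e.trans f⟩ }

/-- The combinatorial types of `2`-simple `2`-simplicial `4`-polytopes with `m` vertices. -/
def CombinatorialType (m : ℕ) : Type :=
  Quotient (combEquiv m)

end Polytopes

/-! Finiteness: a face of a polytope is the hull of the vertices it contains, so the face lattice is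
determined by a family of subsets of an `m`-element set, and there are finitely many such families.

Growth: the polytopes are rectified stacked 3-spheres. Start with the boundary of a 4-simplex and
repeatedly replace a facet by the cone over its boundary; after `n` stackings there are `n + 5`
vertices, `10 + 4 * n` edges and `5 + 3 * n` facets. The rectification has a vertex for every edge
of the sphere. It has a facet for every vertex `a` (the edges at `a`) and an octahedral facet for
every facet `F` (the six edges of `F`). Two facets share at most three vertices and two vertices
share at most three facets (`SphereLike.ncard_facet_inter_le`, `SphereLike.ncard_vertex_inter_le`);
in dimension four this makes the polytope 2-simplicial and 2-simple.

For the realization, all edges at a vertex must be placed in one hyperplane. In homogeneous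
coordinates the sphere has vectors `v a`, the rectification has rays `v a + v b`, and a functional
`h a` takes the value `1` at `v a` and `-1` at its neighbours. When `x` is stacked onto `F`, the
four conditions `h i (v x) = -1`, `i ∈ F`, leave a line of candidates (`apex`, with parameter `t`).
For small `t > 0` all strict inequalities survive (`Realization.exists_closeApex`), and the new
polytope is the old one with a rectified simplex glued to the octahedron of `F`
(`Realization.stack`).

Counting: there are `∏ (5 + 3 * k)`, `k < n`, labelled stacked spheres. The rectification determines
the sphere up to relabelling (`SphereLike.isLeft_iff`, `exists_relabel_of_incidence_equiv`), so the
number of types is at least this product divided by `(n + 5)!`. Consecutive quotients have ratios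
tending to `3`. -/

namespace Polytopes

/-! ### Faces of convex hulls of finite sets -/

/-- An exposed face of a polytope is the convex hull of the vertices that it contains. -/
theorem convexHull_inter_eq_of_isExposed {d : ℕ} {S F : Set (EuclideanSpace ℝ (Fin d))}
    (hS : S.Finite) (hF : IsExposed ℝ (convexHull ℝ S) F) :
    convexHull ℝ (F ∩ S) = F := by
  have hcomp : IsCompact F := hF.isCompact (hS.isCompact_convexHull ℝ)
  have hconv : Convex ℝ F := hF.convex (convex_convexHull ℝ S)
  apply Set.Subset.antisymm (convexHull_min Set.inter_subset_left hconv)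
  have hfin : (F ∩ S).Finite := hS.subset Set.inter_subset_right
  -- Krein–Milman for `F`; its extreme points are extreme in the whole hull, hence belong to `S`.
  conv_lhs => rw [← closure_convexHull_extremePoints hcomp hconv]
  refine closure_minimal (convexHull_mono ?_) (hfin.isClosed_convexHull ℝ)
  rw [hF.isExtreme.extremePoints_eq]
  exact Set.inter_subset_inter_right _ extremePoints_convexHull_subset

theorem convexHull_extremePoints_eq {d : ℕ} {S : Set (EuclideanSpace ℝ (Fin d))}
    (hS : S.Finite) : convexHull ℝ ((convexHull ℝ S).extremePoints ℝ) = convexHull ℝ S := by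
  have hfin : ((convexHull ℝ S).extremePoints ℝ).Finite :=
    hS.subset extremePoints_convexHull_subset
  have h := closure_convexHull_extremePoints (hS.isCompact_convexHull ℝ) (convex_convexHull ℝ S)
  rwa [(hfin.isClosed_convexHull ℝ).closure_eq] at h

/-- The family of vertex sets of the faces of `P`, the vertices being numbered by `f`. -/
def faceVertexSets {d m : ℕ} (P : Set (EuclideanSpace ℝ (Fin d)))
    (f : Fin m → EuclideanSpace ℝ (Fin d)) : Set (Set (Fin m)) :=
  Set.range fun F : FaceLattice P => f ⁻¹' F.1

/-- The face lattice of a polytope is isomorphic to the family of vertex sets of its faces. -/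
theorem nonempty_faceLattice_orderIso {d m : ℕ} {P : Set (EuclideanSpace ℝ (Fin d))}
    (f : Fin m → EuclideanSpace ℝ (Fin d)) (hP : P = convexHull ℝ (Set.range f)) :
    Nonempty (FaceLattice P ≃o faceVertexSets P f) := by
  subst hP
  have key : ∀ F G : FaceLattice (convexHull ℝ (Set.range f)),
      f ⁻¹' F.1 ⊆ f ⁻¹' G.1 ↔ F.1 ⊆ G.1 := by
    intro F G
    refine ⟨fun h => ?_, fun h => Set.preimage_mono h⟩
    rw [← convexHull_inter_eq_of_isExposed (Set.finite_range f) F.2,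
      ← convexHull_inter_eq_of_isExposed (Set.finite_range f) G.2]
    apply convexHull_mono
    rintro _ ⟨hx, i, rfl⟩
    exact ⟨h hx, i, rfl⟩
  let g : FaceLattice (convexHull ℝ (Set.range f)) ↪o Set (Fin m) :=
    OrderEmbedding.ofMapLEIff (fun F => f ⁻¹' F.1) key
  exact ⟨g.orderIso⟩

/-- Sending a type to the family of vertex sets of the faces of a representative is an injection
into the finite type `Set (Set (Fin m))`. -/
theorem finite_combinatorialType (m : ℕ) : Finite (CombinatorialType m) := by
  have num : ∀ P : TwoSTwoSPolytope m, ∃ f : Fin m → EuclideanSpace ℝ (Fin 4),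
      P.1 = convexHull ℝ (Set.range f) := by
    rintro ⟨P, ⟨⟨S, hS, rfl⟩, -⟩, -, -, hm⟩
    set X := (convexHull ℝ S).extremePoints ℝ with hX
    have hfin : X.Finite := hS.subset extremePoints_convexHull_subset
    have hcard : Nat.card X = m := by
      rw [Nat.card_coe_set_eq, Set.ncard_def, hm]; rfl
    have := hfin.to_subtype
    let e := (Finite.equivFinOfCardEq hcard).symm
    refine ⟨fun i => (e i).1, ?_⟩
    have : Set.range (fun i => (e i).1) = X := by
      rw [show (fun i => (e i).1) = Subtype.val ∘ e from rfl, EquivLike.range_comp, Subtype.range_coe]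
    rw [this, hX, convexHull_extremePoints_eq hS]
  choose f hf using num
  let Φ : CombinatorialType m → Set (Set (Fin m)) :=
    fun c => faceVertexSets c.out.1 (f c.out)
  apply Finite.of_injective Φ
  intro c c' h
  rw [← Quotient.out_eq c, ← Quotient.out_eq c']
  apply Quotient.sound
  obtain ⟨e⟩ := nonempty_faceLattice_orderIso (f c.out) (hf c.out)
  obtain ⟨e'⟩ := nonempty_faceLattice_orderIso (f c'.out) (hf c'.out)
  have h' : faceVertexSets c.out.1 (f c.out) = faceVertexSets c'.out.1 (f c'.out) := h
  exact ⟨e.trans ((OrderIso.setCongr _ _ h').trans e'.symm)⟩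

/-! ### Polytopes given by points and by inequalities -/

/-- `P` is the convex hull of the points `q i` and the solution set of the inequalities
`⟪a k, x⟫ ≤ 1`. -/
structure DoubleDescription {d : ℕ} {ι κ : Type*} (P : Set (EuclideanSpace ℝ (Fin d)))
    (q : ι → EuclideanSpace ℝ (Fin d)) (a : κ → EuclideanSpace ℝ (Fin d)) : Prop where
  hull : P = convexHull ℝ (Set.range q)
  ineq : P = {x | ∀ k, inner ℝ (a k) x ≤ 1}

/-! ### Faces and polars of polytopes with both descriptions. -/

namespace DoubleDescription

variable {d : ℕ} {ι κ : Type*} {P : Set (EuclideanSpace ℝ (Fin d))}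
  {q : ι → EuclideanSpace ℝ (Fin d)} {a : κ → EuclideanSpace ℝ (Fin d)}

theorem inner_le (D : DoubleDescription P q a) {x : EuclideanSpace ℝ (Fin d)} (hx : x ∈ P)
    (k : κ) : inner ℝ (a k) x ≤ 1 := by
  rw [D.ineq] at hx; exact hx k

theorem point_mem (D : DoubleDescription P q a) (i : ι) : q i ∈ P := by
  rw [D.hull]; exact subset_convexHull ℝ _ ⟨i, rfl⟩

theorem convex (D : DoubleDescription P q a) : Convex ℝ P := by
  rw [D.hull]; exact convex_convexHull ℝ _

theorem convexHull_inter_eq [Finite ι] (D : DoubleDescription P q a)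
    {F : Set (EuclideanSpace ℝ (Fin d))} (hF : IsExposed ℝ P F) :
    convexHull ℝ (F ∩ Set.range q) = F := by
  rw [D.hull] at hF
  exact convexHull_inter_eq_of_isExposed (Set.finite_range q) hF

theorem isCompact [Finite ι] (D : DoubleDescription P q a) : IsCompact P := by
  rw [D.hull]; exact (Set.finite_range q).isCompact_convexHull ℝ

theorem zero_mem_interior [Finite κ] (D : DoubleDescription P q a) : 0 ∈ interior P := by
  have ho : IsOpen {x : EuclideanSpace ℝ (Fin d) | ∀ k, inner ℝ (a k) x < 1} := by
    rw [Set.ofPred_forall]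
    exact isOpen_iInter_of_finite fun k => isOpen_lt (by fun_prop) continuous_const
  refine mem_interior.2 ⟨_, ?_, ho, by simp⟩
  intro x hx
  rw [D.ineq]
  exact fun k => (hx k).le

theorem isPolytope [Finite ι] [Finite κ] (D : DoubleDescription P q a) : IsPolytope P := by
  refine ⟨⟨_, Set.finite_range q, D.hull⟩, ?_⟩
  have h := isOpen_interior.affineSpan_eq_top ⟨_, D.zero_mem_interior⟩
  exact top_unique (h ▸ affineSpan_mono ℝ interior_subset)

/-- A nonempty face contains a point that satisfies as few as possible of the inequalities with
equality; the face is a neighbourhood of it in the flat that these equalities define. -/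
theorem exists_relative_interior_point [Finite κ] (D : DoubleDescription P q a)
    {F : Set (EuclideanSpace ℝ (Fin d))} (hF : IsExposed ℝ P F) (hne : F.Nonempty) :
    ∃ x ∈ F, (∀ k, inner ℝ (a k) x = 1 → ∀ y ∈ F, inner ℝ (a k) y = 1) ∧
      ∀ u, (∀ k, inner ℝ (a k) x = 1 → inner ℝ (a k) u = 0) → ∃ ε : ℝ, 0 < ε ∧ x + ε • u ∈ F := by
  have hconv : Convex ℝ F := hF.convex D.convex
  let tight : EuclideanSpace ℝ (Fin d) → Set κ := fun x => {k | inner ℝ (a k) x = 1}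
  obtain ⟨x, hxF, hmin⟩ : ∃ x ∈ F, ∀ y ∈ F, (tight x).ncard ≤ (tight y).ncard := by
    have := (inferInstance : WellFoundedLT ℕ).wf.has_min ((fun x => (tight x).ncard) '' F)
      (hne.image _)
    obtain ⟨_, ⟨x, hx, rfl⟩, h⟩ := this
    exact ⟨x, hx, fun y hy => not_lt.1 (h _ ⟨y, hy, rfl⟩)⟩
  obtain ⟨l, hl⟩ := hF hne
  have hxm : ∀ y ∈ P, l y ≤ l x := by rw [hl] at hxF; exact hxF.2
  refine ⟨x, hxF, fun k hk y hy => ?_, fun u hu => ?_⟩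
  -- An inequality is tight at a midpoint only if it is tight at both ends, so minimality at `x`
  -- makes the inequalities tight at `x` tight at `y` too.
  · have hm : midpoint ℝ x y ∈ F := hconv.midpoint_mem hxF hy
    have hsub : tight (midpoint ℝ x y) ⊆ tight x ∩ tight y := by
      intro j hj
      have hj' : inner ℝ (a j) (midpoint ℝ x y) = (1 : ℝ) := hj
      rw [midpoint_eq_smul_add, inner_smul_right, inner_add_right] at hj'
      have h1 := D.inner_le (hF.subset hxF) j
      have h2 := D.inner_le (hF.subset hy) j
      norm_num at hj'
      exact ⟨by change inner ℝ (a j) x = 1; linarith, by change inner ℝ (a j) y = 1; linarith⟩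
    have heq : tight (midpoint ℝ x y) = tight x :=
      Set.eq_of_subset_of_ncard_le (hsub.trans Set.inter_subset_left) (hmin _ hm)
    exact (hsub (heq ▸ hk : k ∈ tight (midpoint ℝ x y))).2
  · have small : ∀ u : EuclideanSpace ℝ (Fin d),
        (∀ k, inner ℝ (a k) x = 1 → inner ℝ (a k) u = 0) →
        ∀ᶠ ε in nhdsWithin (0 : ℝ) (Set.Ioi 0), x + ε • u ∈ P := by
      intro u hu
      have : ∀ k, ∀ᶠ ε in nhdsWithin (0 : ℝ) (Set.Ioi 0), inner ℝ (a k) (x + ε • u) ≤ 1 := by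
        intro k
        by_cases hk : inner ℝ (a k) x = 1
        · filter_upwards with ε
          rw [inner_add_right, inner_smul_right, hu k hk, hk]; simp
        · have hlt : inner ℝ (a k) x < 1 := lt_of_le_of_ne (D.inner_le (hF.subset hxF) k) hk
          have hc : Continuous fun ε : ℝ => (inner ℝ (a k) (x + ε • u) : ℝ) := by fun_prop
          have h0 : ∀ᶠ ε in nhds (0 : ℝ), inner ℝ (a k) (x + ε • u) < 1 :=
            hc.continuousAt.eventually_lt continuousAt_const (by simpa using hlt)
          exact (h0.filter_mono nhdsWithin_le_nhds).mono fun _ h => h.le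
      filter_upwards [Filter.eventually_all.2 this] with ε hε
      rw [D.ineq]; exact hε
    have hu' : ∀ k, inner ℝ (a k) x = 1 → inner ℝ (a k) (-u) = 0 := fun k hk => by
      rw [inner_neg_right, hu k hk, neg_zero]
    -- Both `x + ε • u` and `x - ε • u` stay in `P`, and `l` is maximal at `x`; hence `l u = 0` and
    -- the moved point is still in the face.
    obtain ⟨ε, ⟨h1, h2⟩, hε⟩ :=
      (((small u hu).and (small (-u) hu')).and self_mem_nhdsWithin).exists
    have hε' : 0 < ε := hε
    refine ⟨ε, hε', ?_⟩
    have e1 := hxm _ h1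
    have e2 := hxm _ h2
    simp only [map_add, map_smul, map_neg, smul_eq_mul] at e1 e2
    have hlu : ε * l u = 0 := le_antisymm (by linarith) (by linarith)
    rw [hl]
    refine ⟨h1, fun y hy => ?_⟩
    simp only [map_add, map_smul, smul_eq_mul, hlu, add_zero]
    exact hxm y hy

/-- Every proper nonempty face lies in the hyperplane of one of the inequalities. -/
theorem exists_tight_of_ne [Finite κ] (D : DoubleDescription P q a)
    {F : Set (EuclideanSpace ℝ (Fin d))} (hF : IsExposed ℝ P F) (hne : F.Nonempty)
    (hFP : F ≠ P) : ∃ k, ∀ y ∈ F, inner ℝ (a k) y = 1 := by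
  obtain ⟨x, hx, htight, hflat⟩ := D.exists_relative_interior_point hF hne
  by_contra! hno
  have hfree : ∀ k, inner ℝ (a k) x ≠ 1 := fun k hk => by
    obtain ⟨y, hy, hy'⟩ := hno k
    exact hy' (htight k hk y hy)
  apply hFP
  apply Set.Subset.antisymm hF.subset
  intro z hz
  -- With nothing tight at `x`, the face continues beyond `x` in the direction away from `z`; if `l
  -- z < l x`, then `l` would exceed its maximum there.
  obtain ⟨ε, hε, hmem⟩ := hflat (x - z) fun k hk => absurd hk (hfree k)
  obtain ⟨l, hl⟩ := hF hne
  have hx' := hx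
  rw [hl] at hmem hx' ⊢
  have h1 := hmem.2 x hx'.1
  have h2 := hx'.2 z hz
  simp only [map_add, map_smul, map_sub, smul_eq_mul] at h1
  have h3 : l z = l x := by
    apply le_antisymm h2
    by_contra! hlt
    nlinarith [hx'.2 _ hmem.1, mul_pos hε (sub_pos.2 hlt), map_add l x (ε • (x - z)),
      map_smul l ε (x - z), map_sub l x z, smul_eq_mul ε (l (x - z))]
  exact ⟨hz, fun y hy => h3 ▸ hx'.2 y hy⟩

/-- A face of codimension at least two satisfies two of the inequalities with equality. -/
theorem exists_two_tight [Finite κ] (D : DoubleDescription P q a)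
    {F : Set (EuclideanSpace ℝ (Fin d))} (hF : IsExposed ℝ P F) (hne : F.Nonempty)
    (hdim : Module.finrank ℝ (vectorSpan ℝ F) + 2 ≤ d) :
    ∃ k k', k ≠ k' ∧ (∀ y ∈ F, inner ℝ (a k) y = 1) ∧ ∀ y ∈ F, inner ℝ (a k') y = 1 := by
  obtain ⟨x, hx, htight, hflat⟩ := D.exists_relative_interior_point hF hne
  by_contra! hno
  have hsub : {k | inner ℝ (a k) x = (1 : ℝ)}.Subsingleton := by
    intro k hk k' hk'
    by_contra hkk
    obtain ⟨y, hy, h⟩ := hno k k' hkk (htight k hk)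
    exact h (htight k' hk' y hy)
  -- At most one inequality is tight at `x`. If none is, `b = 0` is chosen, whose kernel is the
  -- whole space; in either case the face has dimension at least `d - 1`.
  obtain ⟨b, hb⟩ : ∃ b : EuclideanSpace ℝ (Fin d),
      ∀ k, inner ℝ (a k) x = (1 : ℝ) → a k = b := by
    rcases hsub.eq_empty_or_singleton with h | ⟨k, h⟩
    · exact ⟨0, fun k hk => absurd (h ▸ hk : k ∈ (∅ : Set κ)) (by simp)⟩
    · exact ⟨a k, fun j hj => by rw [(h ▸ hj : j ∈ ({k} : Set κ))]⟩
  have hle : LinearMap.ker (innerSL ℝ b).toLinearMap ≤ vectorSpan ℝ F := by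
    intro u hu
    have hu' : inner ℝ b u = (0 : ℝ) := by simpa using hu
    obtain ⟨ε, hε, hmem⟩ := hflat u fun k hk => by rw [hb k hk]; exact hu'
    have := vsub_mem_vectorSpan ℝ hmem hx
    rw [vsub_eq_sub, add_sub_cancel_left] at this
    exact (Submodule.smul_mem_iff _ hε.ne').1 this
  have h1 := Submodule.finrank_mono hle
  have h2 := LinearMap.finrank_range_add_finrank_ker (innerSL ℝ b).toLinearMap
  have h3 := Submodule.finrank_le (LinearMap.range (innerSL ℝ b).toLinearMap)
  simp only [finrank_euclideanSpace, Fintype.card_fin, Module.finrank_self] at h2 h3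
  omega

/-- As `d ≥ 4`, a 2-face has codimension at least two and so lies in two of the hyperplanes. It is
then the hull of at most three of the points, and its dimension forces exactly three, affinely
independent. -/
theorem isTwoSimplicial [Finite ι] [Finite κ] (hd : 4 ≤ d) (D : DoubleDescription P q a)
    (h : ∀ k k', k ≠ k' →
      {i | inner ℝ (a k) (q i) = (1 : ℝ) ∧ inner ℝ (a k') (q i) = (1 : ℝ)}.ncard ≤ 3) :
    IsTwoSimplicial P := by
  rintro F ⟨hF, hdim⟩
  have hne : F.Nonempty := by
    rw [Set.nonempty_iff_ne_empty]; intro h0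
    rw [h0, vectorSpan_empty, finrank_bot] at hdim
    omega
  obtain ⟨k, k', hkk, hk, hk'⟩ := D.exists_two_tight hF hne (by omega)
  set Q : Set (EuclideanSpace ℝ (Fin d)) := F ∩ Set.range q with hQ
  have hFQ : convexHull ℝ Q = F := D.convexHull_inter_eq hF
  have hQfin : Q.Finite := (Set.finite_range q).subset Set.inter_subset_right
  have hle : Q.ncard ≤ 3 := by
    refine le_trans ?_ (h k k' hkk)
    refine le_trans (Set.ncard_le_ncard ?_ (Set.toFinite _)) (Set.ncard_image_le (f := q)
      (Set.toFinite _))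
    rintro _ ⟨hx, i, rfl⟩
    exact ⟨i, ⟨hk _ hx, hk' _ hx⟩, rfl⟩
  have hspan : Module.finrank ℝ (vectorSpan ℝ Q) = 2 := by
    rw [← hdim, ← hFQ, ← direction_affineSpan, ← direction_affineSpan, affineSpan_convexHull]
  have hQne : Q.Nonempty := by
    rw [Set.nonempty_iff_ne_empty]; intro h0
    rw [h0, vectorSpan_empty] at hspan; simp at hspan
  have hge : 3 ≤ Q.ncard := by
    have hpos : 0 < Q.ncard := (Set.ncard_pos hQfin).2 hQne
    have := finrank_vectorSpan_image_finset_le ℝ (id : EuclideanSpace ℝ (Fin d) → _)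
      hQfin.toFinset (n := Q.ncard - 1) (by rw [← Set.ncard_eq_toFinset_card _ hQfin]; omega)
    rw [Finset.image_id, hQfin.coe_toFinset, hspan] at this
    omega
  have hcard : Nat.card Q = 3 := by rw [Nat.card_coe_set_eq]; omega
  have := hQfin.to_subtype
  let e := (Finite.equivFinOfCardEq hcard).symm
  have hrange : Set.range (fun i => (e i).1) = Q := by
    rw [show (fun i => (e i).1) = Subtype.val ∘ e from rfl, EquivLike.range_comp, Subtype.range_coe]
  refine ⟨fun i => (e i).1, ?_, by rw [hrange, hFQ]⟩
  rw [affineIndependent_iff_finrank_vectorSpan_eq ℝ _ (n := 2) (by simp), hrange, hspan]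

/-- The polar dual is described by the same vectors with exchanged roles. -/
theorem polar [Finite ι] [Finite κ] [Nonempty κ] (D : DoubleDescription P q a) :
    DoubleDescription (polarDual P 0) a q := by
  have hineq : polarDual P 0 = {y | ∀ i, inner ℝ (q i) y ≤ 1} := by
    ext y
    simp only [polarDual, sub_zero, Set.mem_ofPred_eq]
    refine ⟨fun h i => h _ (D.point_mem i), fun h x hx => ?_⟩
    rw [D.hull] at hx
    have hc : Convex ℝ {x : EuclideanSpace ℝ (Fin d) | inner ℝ x y ≤ 1} :=
      convex_halfSpace_le (f := fun x => inner ℝ x y)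
        ⟨fun _ _ => inner_add_left _ _ _, fun _ _ => real_inner_smul_left _ _ _⟩ 1
    exact convexHull_min (by rintro _ ⟨i, rfl⟩; exact h i) hc hx
  refine ⟨Set.Subset.antisymm ?_ ?_, hineq⟩
  · intro y hy
    by_contra hny
    -- The separating functional is the inner product with some `u`. Once `c > 0` is known, `c⁻¹ •
    -- u` is a point of `P` that shows `y` to be outside the polar.
    obtain ⟨f, c, hf, hfy⟩ := geometric_hahn_banach_closed_point (convex_convexHull ℝ (Set.range a))
      ((Set.finite_range a).isClosed_convexHull ℝ) hny
    obtain ⟨u, rfl⟩ := (InnerProductSpace.toDual ℝ (EuclideanSpace ℝ (Fin d))).surjective f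
    simp only [InnerProductSpace.toDual_apply_apply] at hf hfy
    have hfa : ∀ k, inner ℝ (a k) u < c := fun k => by
      rw [real_inner_comm]; exact hf _ (subset_convexHull ℝ _ ⟨k, rfl⟩)
    have hc : 0 < c := by
      -- If `c ≤ 0`, the whole ray through `u` satisfies the inequalities, contradicting the
      -- boundedness of `P`.
      by_contra! hc
      have hray : ∀ t : ℝ, 0 ≤ t → t • u ∈ P := fun t ht => by
        rw [D.ineq]; intro k
        rw [inner_smul_right]
        have := hfa k
        nlinarith
      obtain ⟨R, hR⟩ := D.isCompact.isBounded.exists_norm_le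
      have hu : u ≠ 0 := by
        rintro rfl
        have := hfa (Classical.arbitrary κ)
        simp only [inner_zero_right] at this
        linarith
      have hun : 0 < ‖u‖ := norm_pos_iff.2 hu
      have hR0 : 0 ≤ R := (norm_nonneg _).trans (hR _ (hray 0 le_rfl))
      have := hR _ (hray ((R + 1) / ‖u‖) (by positivity))
      rw [norm_smul, Real.norm_of_nonneg (by positivity), div_mul_cancel₀ _ hun.ne'] at this
      linarith
    have hmem : c⁻¹ • u ∈ P := by
      rw [D.ineq]; intro k
      rw [inner_smul_right, inv_mul_le_iff₀ hc]
      linarith [hfa k]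
    have := hy _ hmem
    rw [sub_zero, real_inner_smul_left, inv_mul_le_iff₀ hc] at this
    linarith
  · refine convexHull_min ?_ ?_
    · rintro _ ⟨k, rfl⟩ x hx
      rw [sub_zero, real_inner_comm]; exact D.inner_le hx k
    · rw [hineq, Set.ofPred_forall]
      exact convex_iInter fun i => convex_halfSpace_le (f := fun x => inner ℝ (q i) x)
        ⟨fun _ _ => inner_add_right _ _ _, fun _ _ => inner_smul_right _ _ _⟩ 1

/-- Polarity at `0` transposes the incidences, so this is `isTwoSimplicial` for the polar. -/
theorem isTwoSimple [Finite ι] [Finite κ] [Nonempty κ] (hd : 4 ≤ d) (D : DoubleDescription P q a)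
    (h : ∀ i i', i ≠ i' →
      {k | inner ℝ (a k) (q i) = (1 : ℝ) ∧ inner ℝ (a k) (q i') = (1 : ℝ)}.ncard ≤ 3) :
    IsTwoSimple P :=
  ⟨0, D.zero_mem_interior, D.polar.isTwoSimplicial hd fun i i' hi => by
    simpa only [real_inner_comm] using h i i' hi⟩

/-! ### Vertices and facets -/

/-- The points that satisfy the inequalities in `S` with equality form a face. -/
theorem isExposed_tight (D : DoubleDescription P q a) (S : Finset κ) :
    IsExposed ℝ P {x | x ∈ P ∧ ∀ k ∈ S, inner ℝ (a k) x = 1} := by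
  rintro ⟨z, hzP, hz⟩
  -- Each summand is at most `1` on `P`, and `z` attains this bound for all of them, so the
  -- maximizers of the sum are the points where every summand is `1`.
  refine ⟨∑ k ∈ S, innerSL ℝ (a k), ?_⟩
  ext x
  simp only [Set.mem_ofPred_eq, sum_apply, innerSL_apply_apply]
  refine and_congr_right fun hx => ⟨fun h y hy => ?_, fun h k hk => ?_⟩
  · exact Finset.sum_le_sum fun k hk => (D.inner_le hy k).trans (h k hk).ge
  · by_contra hne
    have hlt : inner ℝ (a k) x < 1 := lt_of_le_of_ne (D.inner_le hx k) hne
    have := h z hzP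
    have h2 : ∑ k ∈ S, inner ℝ (a k) x < ∑ k ∈ S, (inner ℝ (a k) z : ℝ) :=
      Finset.sum_lt_sum (fun j hj => (D.inner_le hx j).trans (hz j hj).ge)
        ⟨k, hk, by rw [hz k hk]; exact hlt⟩
    linarith

/-- The face cut out by all inequalities tight at `q i` contains no other of the points, and a face
is the hull of the points in it. -/
theorem isExposed_point [Finite ι] [Finite κ] (D : DoubleDescription P q a)
    (hq : ∀ i j, (∀ k, inner ℝ (a k) (q i) = (1 : ℝ) → inner ℝ (a k) (q j) = (1 : ℝ)) → i = j)
    (i : ι) : IsExposed ℝ P {q i} := by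
  classical
  have := Fintype.ofFinite κ
  have h := D.isExposed_tight (Finset.univ.filter fun k => inner ℝ (a k) (q i) = (1 : ℝ))
  set F := {x | x ∈ P ∧
    ∀ k ∈ Finset.univ.filter fun k => inner ℝ (a k) (q i) = (1 : ℝ), inner ℝ (a k) x = (1 : ℝ)}
  have hF : F ∩ Set.range q = {q i} := by
    ext x
    constructor
    · rintro ⟨hx, j, rfl⟩
      rw [hq i j fun k hk => hx.2 k (by simp [hk])]; rfl
    · rintro rfl
      exact ⟨⟨D.point_mem i, fun k hk => by simpa using hk⟩, i, rfl⟩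
  have := D.convexHull_inter_eq h
  rw [hF, convexHull_singleton] at this
  rwa [this]

theorem extremePoints_eq [Finite ι] [Finite κ] (D : DoubleDescription P q a)
    (hq : ∀ i j, (∀ k, inner ℝ (a k) (q i) = (1 : ℝ) → inner ℝ (a k) (q j) = (1 : ℝ)) → i = j) :
    P.extremePoints ℝ = Set.range q := by
  apply Set.Subset.antisymm
  · rw [D.hull]; exact extremePoints_convexHull_subset
  · rintro _ ⟨i, rfl⟩
    exact exposedPoints_subset_extremePoints
      (mem_exposedPoints_iff_exposed_singleton.2 (D.isExposed_point hq i))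

theorem injective_point
    (hq : ∀ i j, (∀ k, inner ℝ (a k) (q i) = (1 : ℝ) → inner ℝ (a k) (q j) = (1 : ℝ)) → i = j) :
    Function.Injective q := fun i j h => hq i j fun _ hk => h ▸ hk

end DoubleDescription

instance {d : ℕ} (P : Set (EuclideanSpace ℝ (Fin d))) : BoundedOrder (FaceLattice P) where
  top := ⟨P, IsExposed.refl P⟩
  le_top F := F.2.subset
  bot := ⟨∅, isExposed_empty⟩
  bot_le F := Set.empty_subset F.1

namespace DoubleDescription

variable {d : ℕ} {ι κ : Type*} {P : Set (EuclideanSpace ℝ (Fin d))}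
  {q : ι → EuclideanSpace ℝ (Fin d)} {a : κ → EuclideanSpace ℝ (Fin d)}

/-- The face of the solutions of the `k`-th inequality with equality. -/
def facet (D : DoubleDescription P q a) (k : κ) : FaceLattice P :=
  ⟨{x | x ∈ P ∧ ∀ j ∈ ({k} : Finset κ), inner ℝ (a j) x = 1}, D.isExposed_tight {k}⟩

theorem mem_facet (D : DoubleDescription P q a) (k : κ) (x : EuclideanSpace ℝ (Fin d)) :
    x ∈ (D.facet k).1 ↔ x ∈ P ∧ inner ℝ (a k) x = (1 : ℝ) := by
  simp [facet]

/-- No vertex-facet incidence is implied by the others: the points are the vertices and the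
inequalities define the facets. -/
structure Irredundant (q : ι → EuclideanSpace ℝ (Fin d)) (a : κ → EuclideanSpace ℝ (Fin d)) :
    Prop where
  points : ∀ i j, (∀ k, inner ℝ (a k) (q i) = (1 : ℝ) → inner ℝ (a k) (q j) = (1 : ℝ)) → i = j
  facets : ∀ k l, (∀ i, inner ℝ (a k) (q i) = (1 : ℝ) → inner ℝ (a l) (q i) = (1 : ℝ)) → k = l
  exists_point : ∀ k, ∃ i, inner ℝ (a k) (q i) = (1 : ℝ)

theorem isAtom_iff [Finite ι] [Finite κ] (D : DoubleDescription P q a) (I : Irredundant q a)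
    (F : FaceLattice P) : IsAtom F ↔ ∃ i, F = ⟨{q i}, D.isExposed_point I.points i⟩ := by
  constructor
  · intro hF
    have hne : F.1.Nonempty := by
      rw [Set.nonempty_iff_ne_empty]; intro h
      exact hF.1 (Subtype.ext h)
    rw [← D.convexHull_inter_eq F.2, convexHull_nonempty_iff] at hne
    obtain ⟨_, hx, i, rfl⟩ := hne
    refine ⟨i, ?_⟩
    by_contra hne
    have hlt : (⟨{q i}, D.isExposed_point I.points i⟩ : FaceLattice P) < F :=
      lt_of_le_of_ne (Set.singleton_subset_iff.2 hx) (Ne.symm hne)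
    exact (Set.singleton_ne_empty (q i)) (congrArg Subtype.val (hF.2 _ hlt))
  · rintro ⟨i, rfl⟩
    refine ⟨fun h => Set.singleton_ne_empty (q i) (congrArg Subtype.val h), fun G hG => ?_⟩
    rcases Set.subset_singleton_iff_eq.1 hG.le with h | h
    · exact Subtype.ext h
    · exact absurd (Subtype.ext h) hG.ne

theorem facet_ne_top (D : DoubleDescription P q a) (k : κ) : D.facet k ≠ ⊤ := by
  intro h
  have h0 : (0 : EuclideanSpace ℝ (Fin d)) ∈ P := by rw [D.ineq]; simp
  have : (0 : EuclideanSpace ℝ (Fin d)) ∈ (D.facet k).1 := by rw [h]; exact h0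
  rw [mem_facet] at this
  simp at this

theorem le_facet_of_ne_top [Finite κ] (D : DoubleDescription P q a)
    {F : FaceLattice P} (hne : F.1.Nonempty) (hF : F ≠ ⊤) : ∃ k, F ≤ D.facet k := by
  obtain ⟨k, hk⟩ := D.exists_tight_of_ne F.2 hne fun h => hF (Subtype.ext h)
  exact ⟨k, fun x hx => (D.mem_facet k x).2 ⟨F.2.subset hx, hk x hx⟩⟩

theorem eq_of_facet_le (D : DoubleDescription P q a) (I : Irredundant q a) {k l : κ}
    (h : D.facet k ≤ D.facet l) : k = l :=
  I.facets k l fun i hi => ((D.mem_facet l _).1 (h ((D.mem_facet k _).2 ⟨D.point_mem i, hi⟩))).2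

theorem facet_nonempty (D : DoubleDescription P q a) (I : Irredundant q a) (k : κ) :
    (D.facet k).1.Nonempty := by
  obtain ⟨i, hi⟩ := I.exists_point k
  exact ⟨q i, (D.mem_facet k _).2 ⟨D.point_mem i, hi⟩⟩

theorem isCoatom_iff [Nonempty κ] [Finite κ] (D : DoubleDescription P q a) (I : Irredundant q a)
    (F : FaceLattice P) : IsCoatom F ↔ ∃ k, F = D.facet k := by
  constructor
  · intro hF
    have hne : F.1.Nonempty := by
      rw [Set.nonempty_iff_ne_empty]; intro h
      -- The empty face is no coatom because some facet lies strictly above it.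
      have k : κ := Classical.arbitrary κ
      have hlt : F < D.facet k := by
        refine lt_of_le_of_ne ?_ ?_
        · change F.1 ⊆ _; rw [h]; exact Set.empty_subset _
        · intro h'; exact (D.facet_nonempty I k).ne_empty (h' ▸ h)
      exact D.facet_ne_top k (hF.2 _ hlt)
    obtain ⟨k, hk⟩ := D.le_facet_of_ne_top hne hF.1
    refine ⟨k, ?_⟩
    by_contra hne'
    exact D.facet_ne_top k (hF.2 _ (lt_of_le_of_ne hk hne'))
  · rintro ⟨k, rfl⟩
    refine ⟨D.facet_ne_top k, fun G hG => ?_⟩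
    by_contra hne
    obtain ⟨l, hl⟩ := D.le_facet_of_ne_top ((D.facet_nonempty I k).mono hG.le) hne
    have := D.eq_of_facet_le I (hG.le.trans hl)
    subst this
    exact absurd hl hG.not_ge

/-- The points correspond to the atoms of the face lattice. -/
noncomputable def atomEquiv [Finite ι] [Finite κ] (D : DoubleDescription P q a)
    (I : Irredundant q a) : ι ≃ {F : FaceLattice P // IsAtom F} :=
  Equiv.ofBijective
    (fun i => ⟨⟨{q i}, D.isExposed_point I.points i⟩, (D.isAtom_iff I _).2 ⟨i, rfl⟩⟩)
    ⟨fun i j h => injective_point I.points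
        (Set.singleton_injective (congrArg (fun x => x.1.1) h)),
      fun F => by
        obtain ⟨i, hi⟩ := (D.isAtom_iff I F.1).1 F.2
        exact ⟨i, Subtype.ext hi.symm⟩⟩

/-- The inequalities correspond to the coatoms of the face lattice. -/
noncomputable def coatomEquiv [Nonempty κ] [Finite κ] (D : DoubleDescription P q a)
    (I : Irredundant q a) : κ ≃ {F : FaceLattice P // IsCoatom F} :=
  Equiv.ofBijective (fun k => ⟨D.facet k, (D.isCoatom_iff I _).2 ⟨k, rfl⟩⟩)
    ⟨fun k l h => D.eq_of_facet_le I (congrArg Subtype.val h).le,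
      fun F => by
        obtain ⟨k, hk⟩ := (D.isCoatom_iff I F.1).1 F.2
        exact ⟨k, Subtype.ext hk.symm⟩⟩

theorem atomEquiv_le_coatomEquiv [Finite ι] [Nonempty κ] [Finite κ] (D : DoubleDescription P q a)
    (I : Irredundant q a) (i : ι) (k : κ) :
    (D.atomEquiv I i).1 ≤ (D.coatomEquiv I k).1 ↔ inner ℝ (a k) (q i) = (1 : ℝ) := by
  change {q i} ⊆ (D.facet k).1 ↔ _
  rw [Set.singleton_subset_iff, mem_facet, and_iff_right (D.point_mem i)]

/-- An isomorphism of face lattices preserves the vertex-facet incidences. -/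
theorem exists_incidence_equiv {ι' κ' : Type*} {P' : Set (EuclideanSpace ℝ (Fin d))}
    {q' : ι' → EuclideanSpace ℝ (Fin d)} {a' : κ' → EuclideanSpace ℝ (Fin d)}
    [Finite ι] [Nonempty κ] [Finite κ] [Finite ι'] [Nonempty κ'] [Finite κ']
    (D : DoubleDescription P q a) (I : Irredundant q a)
    (D' : DoubleDescription P' q' a') (I' : Irredundant q' a')
    (e : FaceLattice P ≃o FaceLattice P') :
    ∃ (φ : ι ≃ ι') (ψ : κ ≃ κ'), ∀ i k,
      inner ℝ (a k) (q i) = (1 : ℝ) ↔ inner ℝ (a' (ψ k)) (q' (φ i)) = (1 : ℝ) := by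
  let ea : {F : FaceLattice P // IsAtom F} ≃ {F : FaceLattice P' // IsAtom F} :=
    e.toEquiv.subtypeEquiv fun F => (e.isAtom_iff F).symm
  let ec : {F : FaceLattice P // IsCoatom F} ≃ {F : FaceLattice P' // IsCoatom F} :=
    e.toEquiv.subtypeEquiv fun F => (e.isCoatom_iff F).symm
  refine ⟨(D.atomEquiv I).trans (ea.trans (D'.atomEquiv I').symm),
    (D.coatomEquiv I).trans (ec.trans (D'.coatomEquiv I').symm), fun i k => ?_⟩
  rw [← D.atomEquiv_le_coatomEquiv I, ← D'.atomEquiv_le_coatomEquiv I']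
  simp only [Equiv.trans_apply, Equiv.apply_symm_apply]
  exact (e.le_iff_le (x := (D.atomEquiv I i).1) (y := (D.coatomEquiv I k).1)).symm

end DoubleDescription

/-! ### Stacked three-spheres -/

/-- The edges of the simplicial complex with facets `K`. -/
def edges (K : Finset (Finset ℕ)) : Finset (Finset ℕ) := K.biUnion (Finset.powersetCard 2)

theorem mem_edges {K : Finset (Finset ℕ)} {e : Finset ℕ} :
    e ∈ edges K ↔ ∃ F ∈ K, e ⊆ F ∧ e.card = 2 := by
  simp [edges, Finset.mem_powersetCard]

/-- Replace the facet `F` by the cone with apex `x` over its boundary. -/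
def stack (K : Finset (Finset ℕ)) (F : Finset ℕ) (x : ℕ) : Finset (Finset ℕ) :=
  K.erase F ∪ F.image fun a => insert x (F.erase a)

theorem mem_stack {K : Finset (Finset ℕ)} {F G : Finset ℕ} {x : ℕ} :
    G ∈ stack K F x ↔ (G ≠ F ∧ G ∈ K) ∨ ∃ a ∈ F, insert x (F.erase a) = G := by
  simp [stack]

/-- The facet sets of the stacked three-spheres with vertices `0, …, n + 4`, the vertices
being stacked in this order. -/
def stackedSpheres : ℕ → Finset (Finset (Finset ℕ))
  | 0 => {Finset.powersetCard 4 (Finset.range 5)}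
  | n + 1 => (stackedSpheres n).biUnion fun K => K.image fun F => stack K F (n + 5)

theorem mem_stackedSpheres_succ {n : ℕ} {L : Finset (Finset ℕ)} :
    L ∈ stackedSpheres (n + 1) ↔ ∃ K ∈ stackedSpheres n, ∃ F ∈ K, stack K F (n + 5) = L := by
  simp [stackedSpheres]

/-- The properties of the facet set of a stacked three-sphere with `n + 5` vertices that are
used below. -/
structure SphereLike (n : ℕ) (K : Finset (Finset ℕ)) : Prop where
  card_facet : ∀ F ∈ K, F.card = 4
  facet_subset : ∀ F ∈ K, F ⊆ Finset.range (n + 5)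
  triangle_le : ∀ T : Finset ℕ, T.card = 3 → (K.filter (T ⊆ ·)).card ≤ 2
  closed : ∀ F ∈ K, ∀ a ∈ F, ∃ G ∈ K, G ≠ F ∧ F.erase a ⊆ G
  -- Edges in only three facets will tell the two kinds of facets of the rectification apart.
  exists_edge : ∀ i < n + 5, ∃ e ∈ edges K, i ∈ e ∧ (K.filter (e ⊆ ·)).card ≤ 3
  card_eq : K.card = 5 + 3 * n
  card_edges : (edges K).card = 10 + 4 * n

theorem sphereLike_simplex : SphereLike 0 (Finset.powersetCard 4 (Finset.range 5)) := by
  have hfilter : ∀ T : Finset ℕ,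
      ((Finset.powersetCard 4 (Finset.range 5)).filter (T ⊆ ·)).card ≤ 5 - T.card := by
    intro T
    by_cases hT : T ⊆ Finset.range 5
    · have : (Finset.powersetCard 4 (Finset.range 5)).filter (T ⊆ ·) ⊆
          (Finset.range 5 \ T).image fun a => (Finset.range 5).erase a := by
        intro F hF
        simp only [Finset.mem_filter, Finset.mem_powersetCard] at hF
        obtain ⟨⟨h1, h2⟩, h3⟩ := hF
        have hc : (Finset.range 5 \ F).card = 1 := by
          rw [Finset.card_sdiff_of_subset h1, h2]; rfl
        obtain ⟨a, ha⟩ := Finset.card_eq_one.1 hc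
        have ha' : a ∈ Finset.range 5 \ F := by rw [ha]; simp
        rw [Finset.mem_sdiff] at ha'
        refine Finset.mem_image.2 ⟨a, Finset.mem_sdiff.2 ⟨ha'.1, fun h => ha'.2 (h3 h)⟩, ?_⟩
        rw [Finset.erase_eq, ← ha, Finset.sdiff_sdiff_eq_self h1]
      refine (Finset.card_le_card this).trans (Finset.card_image_le.trans ?_)
      rw [Finset.card_sdiff_of_subset hT, Finset.card_range]
    · have : (Finset.powersetCard 4 (Finset.range 5)).filter (T ⊆ ·) = ∅ := by
        apply Finset.filter_eq_empty_iff.2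
        intro F hF h
        exact hT (h.trans (Finset.mem_powersetCard.1 hF).1)
      rw [this]; simp
  have hedges : edges (Finset.powersetCard 4 (Finset.range 5)) =
      Finset.powersetCard 2 (Finset.range 5) := by
    decide +kernel
  refine ⟨fun F hF => (Finset.mem_powersetCard.1 hF).2,
    fun F hF => (Finset.mem_powersetCard.1 hF).1, fun T hT => ?_, ?_, fun i hi => ?_, ?_, ?_⟩
  · exact (hfilter T).trans (by omega)
  · decide +kernel
  · obtain ⟨j, hj, hij⟩ : ∃ j ∈ Finset.range 5, j ≠ i :=
      Finset.exists_mem_ne (by simp) i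
    have hc : ({i, j} : Finset ℕ).card = 2 := Finset.card_pair hij.symm
    refine ⟨{i, j}, ?_, by simp, (hfilter _).trans (by omega)⟩
    rw [hedges, Finset.mem_powersetCard]
    refine ⟨?_, hc⟩
    intro k hk
    simp only [Finset.mem_insert, Finset.mem_singleton] at hk
    rcases hk with rfl | rfl
    · exact Finset.mem_range.2 hi
    · exact hj
  · simp [Finset.card_powersetCard]
  · rw [hedges]; simp [Finset.card_powersetCard, Nat.choose]

/-! ### The combinatorics of a single stacking. -/

section Stack

variable {n : ℕ} {K : Finset (Finset ℕ)} {F : Finset ℕ}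

theorem SphereLike.notMem_of_le (hK : SphereLike n K) (hF : F ∈ K) {x : ℕ} (hx : n + 5 ≤ x) :
    x ∉ F := fun h => by
  have := Finset.mem_range.1 (hK.facet_subset F hF h); omega

theorem SphereLike.edge_subset (hK : SphereLike n K) {e : Finset ℕ} (he : e ∈ edges K) :
    e ⊆ Finset.range (n + 5) := by
  obtain ⟨F, hF, h, -⟩ := mem_edges.1 he
  exact h.trans (hK.facet_subset F hF)

/-- No edge is lost: an edge inside `F` misses some vertex `a` of `F` and survives in the cone over
`F.erase a`. -/
theorem edges_stack (hK : SphereLike n K) (hF : F ∈ K) :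
    edges (stack K F (n + 5)) = edges K ∪ F.image fun a => {n + 5, a} := by
  have hx : n + 5 ∉ F := hK.notMem_of_le hF le_rfl
  have h4 := hK.card_facet F hF
  ext e
  simp only [Finset.mem_union, mem_edges, mem_stack, Finset.mem_image]
  constructor
  · rintro ⟨G, ⟨hG, hGK⟩ | ⟨a, ha, rfl⟩, heG, hc⟩
    · exact Or.inl ⟨G, hGK, heG, hc⟩
    · by_cases hxe : n + 5 ∈ e
      · right
        have hc1 : (e.erase (n + 5)).card = 1 := by rw [Finset.card_erase_of_mem hxe, hc]
        obtain ⟨b, hb⟩ := Finset.card_eq_one.1 hc1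
        have hbe : b ∈ e.erase (n + 5) := by rw [hb]; simp
        refine ⟨b, ?_, by rw [← Finset.insert_erase hxe, hb]⟩
        rw [Finset.mem_erase] at hbe
        have := heG hbe.2
        simp only [Finset.mem_insert, Finset.mem_erase] at this
        tauto
      · left
        refine ⟨F, hF, fun b hb => ?_, hc⟩
        have := heG hb
        simp only [Finset.mem_insert, Finset.mem_erase] at this
        rcases this with rfl | h
        · exact absurd hb hxe
        · exact h.2
  · rintro (⟨G, hG, heG, hc⟩ | ⟨a, ha, rfl⟩)
    · by_cases hGF : G = F
      · subst hGF
        obtain ⟨a, ha, hae⟩ : ∃ a ∈ G, a ∉ e :=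
          Finset.exists_mem_notMem_of_card_lt_card (by omega)
        exact ⟨_, Or.inr ⟨a, ha, rfl⟩, fun b hb => Finset.mem_insert_of_mem
          (Finset.mem_erase.2 ⟨fun h => hae (h ▸ hb), heG hb⟩), hc⟩
      · exact ⟨G, Or.inl ⟨hGF, hG⟩, heG, hc⟩
    · obtain ⟨b, hb, hba⟩ := Finset.exists_mem_ne (by omega : 1 < F.card) a
      refine ⟨_, Or.inr ⟨b, hb, rfl⟩, ?_, Finset.card_pair fun h => hx (h ▸ ha)⟩
      intro c hc
      simp only [Finset.mem_insert, Finset.mem_singleton] at hc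
      rcases hc with rfl | rfl
      · simp
      · simp [ha, hba.symm]

theorem insert_erase_injOn {x : ℕ} (hx : x ∉ F) :
    Set.InjOn (fun a => insert x (F.erase a)) (F : Set ℕ) := by
  intro a ha b hb h
  by_contra hab
  have : a ∈ insert x (F.erase b) :=
    Finset.mem_insert_of_mem (Finset.mem_erase.2 ⟨hab, ha⟩)
  simp only at h
  rw [← h] at this
  simp only [Finset.mem_insert, Finset.mem_erase, ne_eq, not_true_eq_false, false_and,
    or_false] at this
  exact hx (this ▸ ha)

/-- A facet at the apex is given by the vertex of `F` that it omits, which must lie outside `T`.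
This bounds the degrees of the new edges by `3` and of the new triangles by `2`. -/
theorem card_stack_filter_le (hF : ∀ G ∈ K, n + 5 ∉ G) (hFK : F ∈ K) {T : Finset ℕ}
    (hT : n + 5 ∈ T) : ((stack K F (n + 5)).filter (T ⊆ ·)).card ≤ (F \ T).card := by
  refine le_trans (Finset.card_le_card (t := (F \ T).image fun a => insert (n + 5) (F.erase a)) ?_)
    Finset.card_image_le
  intro G hG
  rw [Finset.mem_filter, mem_stack] at hG
  obtain ⟨⟨-, hGK⟩ | ⟨a, ha, rfl⟩, hTG⟩ := hG
  · exact absurd (hTG hT) (hF G hGK)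
  · refine Finset.mem_image.2 ⟨a, Finset.mem_sdiff.2 ⟨ha, fun haT => ?_⟩, rfl⟩
    have := hTG haT
    simp only [Finset.mem_insert, Finset.mem_erase, ne_eq, not_true_eq_false, false_and,
      or_false] at this
    exact hF F hFK (this ▸ ha)

theorem sphereLike_stack (hK : SphereLike n K) (hF : F ∈ K) :
    SphereLike (n + 1) (stack K F (n + 5)) := by
  have hx : ∀ G ∈ K, n + 5 ∉ G := fun G hG => hK.notMem_of_le hG le_rfl
  have h4 := hK.card_facet F hF
  have hinj := insert_erase_injOn (hx F hF)
  have hnew : ∀ a ∈ F, insert (n + 5) (F.erase a) ∈ stack K F (n + 5) :=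
    fun a ha => mem_stack.2 (Or.inr ⟨a, ha, rfl⟩)
  have hedge := edges_stack hK hF
  have hpair : ∀ a ∈ F, {n + 5, a} ∈ edges (stack K F (n + 5)) := fun a ha => by
    rw [hedge]; exact Finset.mem_union_right _ (Finset.mem_image_of_mem _ ha)
  have hpairdeg : ∀ a ∈ F,
      ((stack K F (n + 5)).filter (({n + 5, a} : Finset ℕ) ⊆ ·)).card ≤ 3 := fun a ha => by
    refine (card_stack_filter_le hx hF (by simp)).trans ?_
    have : F \ {n + 5, a} ⊆ F.erase a := by
      intro b hb
      simp only [Finset.mem_sdiff, Finset.mem_insert, Finset.mem_singleton, not_or] at hb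
      exact Finset.mem_erase.2 ⟨hb.2.2, hb.1⟩
    refine (Finset.card_le_card this).trans ?_
    rw [Finset.card_erase_of_mem ha, h4]
  refine ⟨?_, ?_, ?_, ?_, ?_, ?_, ?_⟩
  · intro G hG
    rcases mem_stack.1 hG with ⟨-, h⟩ | ⟨a, ha, rfl⟩
    · exact hK.card_facet G h
    · rw [Finset.card_insert_of_notMem fun h => hx F hF (Finset.mem_of_mem_erase h),
        Finset.card_erase_of_mem ha, h4]
  · intro G hG
    rcases mem_stack.1 hG with ⟨-, h⟩ | ⟨a, ha, rfl⟩
    · exact (hK.facet_subset G h).trans (Finset.range_subset_range.2 (by omega))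
    · refine Finset.insert_subset (Finset.mem_range.2 (by omega)) ?_
      exact (Finset.erase_subset _ _).trans
        ((hK.facet_subset F hF).trans (Finset.range_subset_range.2 (by omega)))
  · intro T hT
    by_cases hxT : n + 5 ∈ T
    · by_cases hsub : T.erase (n + 5) ⊆ F
      · refine (card_stack_filter_le hx hF hxT).trans ?_
        have : F \ T = F \ T.erase (n + 5) := by
          ext b
          simp only [Finset.mem_sdiff, Finset.mem_erase, not_and]
          exact ⟨fun h => ⟨h.1, fun _ => h.2⟩,
            fun h => ⟨h.1, h.2 fun hb => hx F hF (hb ▸ h.1)⟩⟩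
        rw [this, Finset.card_sdiff_of_subset hsub, Finset.card_erase_of_mem hxT, hT, h4]
      · rw [Finset.filter_eq_empty_iff.2]
        · simp
        intro G hG hTG
        rcases mem_stack.1 hG with ⟨-, h⟩ | ⟨a, ha, rfl⟩
        · exact hx G h (hTG hxT)
        · apply hsub
          intro b hb
          rw [Finset.mem_erase] at hb
          have := hTG hb.2
          simp only [Finset.mem_insert, Finset.mem_erase] at this
          tauto
    -- For a triangle `T` without the apex, `T ⊆ F` loses the facet `F` and gains at most one cone;
    -- for other `T` nothing is gained.
    · have hsplit : (stack K F (n + 5)).filter (T ⊆ ·) ⊆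
          (K.filter (T ⊆ ·)).erase F ∪
            (F.filter fun a => T ⊆ F.erase a).image fun a => insert (n + 5) (F.erase a) := by
        intro G hG
        rw [Finset.mem_filter, mem_stack] at hG
        obtain ⟨⟨hGF, hGK⟩ | ⟨a, ha, rfl⟩, hTG⟩ := hG
        · exact Finset.mem_union_left _
            (Finset.mem_erase.2 ⟨hGF, Finset.mem_filter.2 ⟨hGK, hTG⟩⟩)
        · refine Finset.mem_union_right _ (Finset.mem_image.2 ⟨a, Finset.mem_filter.2 ⟨ha, ?_⟩, rfl⟩)
          intro b hb
          rcases Finset.mem_insert.1 (hTG hb) with rfl | h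
          · exact absurd hb hxT
          · exact h
      have hK3 := hK.triangle_le T hT
      refine (Finset.card_le_card hsplit).trans ((Finset.card_union_le _ _).trans ?_)
      by_cases hTF : T ⊆ F
      · have h1 : ((K.filter (T ⊆ ·)).erase F).card ≤ 1 := by
          have hmem : F ∈ K.filter (T ⊆ ·) := Finset.mem_filter.2 ⟨hF, hTF⟩
          rw [Finset.card_erase_of_mem hmem]; omega
        have h2 : (F.filter fun a => T ⊆ F.erase a).card ≤ 1 := by
          refine (Finset.card_le_card (t := F \ T) ?_).trans ?_
          · intro a ha
            rw [Finset.mem_filter] at ha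
            exact Finset.mem_sdiff.2 ⟨ha.1, fun h => Finset.notMem_erase a F (ha.2 h)⟩
          · rw [Finset.card_sdiff_of_subset hTF, h4, hT]
        have h3 := Finset.card_image_le (s := F.filter fun a => T ⊆ F.erase a)
          (f := fun a => insert (n + 5) (F.erase a))
        omega
      · rw [Finset.filter_false_of_mem fun a _ (h : T ⊆ F.erase a) => hTF (h.trans (Finset.erase_subset _ _)),
          Finset.image_empty, Finset.card_empty, add_zero]
        exact (Finset.card_le_card (Finset.erase_subset _ _)).trans hK3
  · intro G hG a ha
    rcases mem_stack.1 hG with ⟨hGF, hGK⟩ | ⟨b, hb, rfl⟩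
    · obtain ⟨H, hH, hHG, hsub⟩ := hK.closed G hGK a ha
      -- If the neighbour of `G` was the removed facet, the cone over the common triangle takes its
      -- place.
      by_cases hHF : H = F
      · subst hHF
        have hcard : (G.erase a).card = 3 := by
          rw [Finset.card_erase_of_mem ha, hK.card_facet G hGK]
        obtain ⟨b, hb, hba⟩ : ∃ b ∈ H, b ∉ G.erase a :=
          Finset.exists_mem_notMem_of_card_lt_card (by omega)
        refine ⟨_, hnew b hb, fun h => ?_, fun c hc => ?_⟩
        · exact hx G hGK (h ▸ Finset.mem_insert_self _ _)
        · exact Finset.mem_insert_of_mem (Finset.mem_erase.2 ⟨fun h => hba (h ▸ hc), hsub hc⟩)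
      · exact ⟨H, mem_stack.2 (Or.inl ⟨hHF, hH⟩), hHG, hsub⟩
    · by_cases hax : a = n + 5
      · subst hax
        obtain ⟨H, hH, hHF, hsub⟩ := hK.closed F hF b hb
        refine ⟨H, mem_stack.2 (Or.inl ⟨hHF, hH⟩), fun h => ?_, fun c hc => hsub ?_⟩
        · exact hx H hH (h ▸ Finset.mem_insert_self _ _)
        · simp only [Finset.mem_erase, Finset.mem_insert] at hc ⊢
          tauto
      · have haF : a ∈ F.erase b := (Finset.mem_insert.1 ha).resolve_left hax
        rw [Finset.mem_erase] at haF
        refine ⟨_, hnew a haF.2, fun h => haF.1 (hinj haF.2 hb h), fun c hc => ?_⟩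
        simp only [Finset.mem_erase, Finset.mem_insert] at hc ⊢
        tauto
  · intro i hi
    by_cases hix : i = n + 5
    · subst hix
      obtain ⟨a, ha⟩ : F.Nonempty := Finset.card_pos.1 (by omega)
      exact ⟨_, hpair a ha, by simp, hpairdeg a ha⟩
    · by_cases hiF : i ∈ F
      · exact ⟨_, hpair i hiF, by simp, hpairdeg i hiF⟩
      -- No new facet contains a vertex outside `F` other than the apex, so an old edge of low
      -- degree at `i` still works.
      · obtain ⟨e, he, hie, hdeg⟩ := hK.exists_edge i (by omega)
        refine ⟨e, by rw [hedge]; exact Finset.mem_union_left _ he, hie,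
          (Finset.card_le_card ?_).trans hdeg⟩
        intro G hG
        rw [Finset.mem_filter, mem_stack] at hG
        obtain ⟨⟨-, hGK⟩ | ⟨a, ha, rfl⟩, heG⟩ := hG
        · exact Finset.mem_filter.2 ⟨hGK, heG⟩
        · have := heG hie
          simp only [Finset.mem_insert, Finset.mem_erase] at this
          tauto
  · rw [stack, Finset.card_union_of_disjoint, Finset.card_erase_of_mem hF,
      Finset.card_image_of_injOn hinj, hK.card_eq, h4]
    · omega
    · rw [Finset.disjoint_left]
      intro G hG hG'
      obtain ⟨a, -, rfl⟩ := Finset.mem_image.1 hG'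
      exact hx _ (Finset.mem_of_mem_erase hG) (Finset.mem_insert_self _ _)
  · rw [hedge, Finset.card_union_of_disjoint, hK.card_edges, Finset.card_image_of_injOn, h4]
    · omega
    · intro a ha b hb h
      have : a ∈ ({n + 5, b} : Finset ℕ) := by
        simp only at h; rw [← h]; simp
      simp only [Finset.mem_insert, Finset.mem_singleton] at this
      exact this.resolve_left fun h' => hx F hF (h' ▸ ha)
    · rw [Finset.disjoint_left]
      intro e he he'
      obtain ⟨a, -, rfl⟩ := Finset.mem_image.1 he'
      have := hK.edge_subset he (Finset.mem_insert_self _ _)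
      simp at this

end Stack

theorem sphereLike_of_mem {n : ℕ} {K : Finset (Finset ℕ)} (hK : K ∈ stackedSpheres n) :
    SphereLike n K := by
  induction n generalizing K with
  | zero =>
    rw [stackedSpheres, Finset.mem_singleton] at hK
    exact hK ▸ sphereLike_simplex
  | succ n ih =>
    obtain ⟨L, hL, F, hF, rfl⟩ := mem_stackedSpheres_succ.1 hK
    exact sphereLike_stack (ih hL) hF

/-! ### The number of labelled stacked spheres -/

/-- The apex has the known label `n + 5`: its neighbours form `F`, and the facets avoiding it form
`K.erase F`. -/
theorem stack_injective {n : ℕ} {K K' : Finset (Finset ℕ)} {F F' : Finset ℕ}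
    (hK : SphereLike n K) (hK' : SphereLike n K') (hF : F ∈ K) (hF' : F' ∈ K')
    (h : stack K F (n + 5) = stack K' F' (n + 5)) : K = K' ∧ F = F' := by
  have facets : ∀ {K : Finset (Finset ℕ)} {F : Finset ℕ}, SphereLike n K → F ∈ K →
      (stack K F (n + 5)).filter (n + 5 ∉ ·) = K.erase F := by
    intro K F hK hF
    ext G
    rw [Finset.mem_filter, mem_stack, Finset.mem_erase]
    constructor
    · rintro ⟨h | ⟨a, -, rfl⟩, hG⟩
      · exact h
      · exact absurd (Finset.mem_insert_self _ _) hG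
    · exact fun h => ⟨Or.inl h, hK.notMem_of_le h.2 le_rfl⟩
  have base : ∀ {K : Finset (Finset ℕ)} {F : Finset ℕ}, SphereLike n K → F ∈ K →
      ∀ b, b ∈ F ↔ b ≠ n + 5 ∧ ∃ G ∈ stack K F (n + 5), n + 5 ∈ G ∧ b ∈ G := by
    intro K F hK hF b
    have hx := hK.notMem_of_le hF (le_refl (n + 5))
    constructor
    · intro hb
      obtain ⟨a, ha, hab⟩ := Finset.exists_mem_ne
        (by rw [hK.card_facet F hF]; omega : 1 < F.card) b
      exact ⟨fun h => hx (h ▸ hb), _, mem_stack.2 (Or.inr ⟨a, ha, rfl⟩), by simp,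
        by simp [hb, hab.symm]⟩
    · rintro ⟨hbx, G, hG, hxG, hbG⟩
      rcases mem_stack.1 hG with ⟨-, hG⟩ | ⟨a, ha, rfl⟩
      · exact absurd hxG (hK.notMem_of_le hG le_rfl)
      · simp only [Finset.mem_insert, Finset.mem_erase] at hbG
        tauto
  have hFF : F = F' := by
    ext b; rw [base hK hF, base hK' hF', h]
  refine ⟨?_, hFF⟩
  rw [← Finset.insert_erase hF, ← Finset.insert_erase hF', ← facets hK hF, ← facets hK' hF', h,
    hFF]

theorem card_stackedSpheres_succ (n : ℕ) :
    (stackedSpheres (n + 1)).card = (stackedSpheres n).card * (5 + 3 * n) := by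
  rw [stackedSpheres, Finset.card_biUnion]
  · rw [Finset.sum_const_nat (m := 5 + 3 * n)]
    intro K hK
    have hS := sphereLike_of_mem hK
    rw [Finset.card_image_of_injOn, hS.card_eq]
    intro F hF F' hF' h
    exact (stack_injective hS hS hF hF' h).2
  · intro K hK K' hK' hne
    rw [Function.onFun, Finset.disjoint_left]
    intro L hL hL'
    obtain ⟨F, hF, rfl⟩ := Finset.mem_image.1 hL
    obtain ⟨F', hF', h⟩ := Finset.mem_image.1 hL'
    exact hne (stack_injective (sphereLike_of_mem hK) (sphereLike_of_mem hK') hF hF' h.symm).1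

/-- From `n` to `n + 1` the quotient by the factorial is multiplied by `(5 + 3 * n) / (n + 6)`,
which is at least `3 / 2` exactly when `n ≥ 3`. The cases up to `3` are checked directly, with the
slack in the constant `1 / 1000`. -/
theorem pow_mul_factorial_le_card_stackedSpheres (n : ℕ) :
    1 / 1000 * (3 / 2 : ℝ) ^ n * (n + 5).factorial ≤ (stackedSpheres n).card := by
  have hsmall : (stackedSpheres 0).card = 1 ∧ (stackedSpheres 1).card = 5 ∧
      (stackedSpheres 2).card = 40 ∧ (stackedSpheres 3).card = 440 := by
    have h0 : (stackedSpheres 0).card = 1 := by simp [stackedSpheres]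
    refine ⟨h0, ?_, ?_, ?_⟩ <;> simp [card_stackedSpheres_succ, h0]
  obtain ⟨h0, h1, h2, h3⟩ := hsmall
  rcases n with _ | _ | _ | n
  · rw [h0, show Nat.factorial (0 + 5) = 120 from rfl]; norm_num
  · rw [h1, show Nat.factorial (0 + 1 + 5) = 720 from rfl]; norm_num
  · rw [h2, show Nat.factorial (0 + 1 + 1 + 5) = 5040 from rfl]; norm_num
  · induction n with
    | zero => rw [h3, show Nat.factorial (0 + 1 + 1 + 1 + 5) = 40320 from rfl]; norm_num
    | succ n ih =>
      have hn : (0 : ℝ) ≤ n := n.cast_nonneg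
      have h := mul_le_mul_of_nonneg_right ih (by linarith : (0 : ℝ) ≤ 3 / 2 * (n + 9))
      have h' : ((stackedSpheres (n + 1 + 1 + 1)).card : ℝ) * (3 / 2 * (n + 9)) ≤
          (stackedSpheres (n + 1 + 1 + 1)).card * (5 + 3 * (n + 3)) :=
        mul_le_mul_of_nonneg_left (by linarith) (Nat.cast_nonneg _)
      have hf : ((n + 1 + 1 + 1 + 1 + 5).factorial : ℝ) =
          (n + 9) * (n + 1 + 1 + 1 + 5).factorial := by
        rw [show n + 1 + 1 + 1 + 1 + 5 = (n + 1 + 1 + 1 + 5) + 1 by ring, Nat.factorial_succ]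
        push_cast; ring
      have hs : ((stackedSpheres (n + 1 + 1 + 1 + 1)).card : ℝ) =
          (stackedSpheres (n + 1 + 1 + 1)).card * (5 + 3 * (n + 3)) := by
        rw [card_stackedSpheres_succ]; push_cast; ring
      rw [hf, hs, pow_succ]
      generalize ((n + 1 + 1 + 1 + 5).factorial : ℝ) = f at *
      linarith

/-! ### The incidence structure of a rectified stacked sphere -/

/-- The incidence of edges with the vertices and the facets of a complex: the vertex-facet
incidence of the rectification. -/
def Incident {n : ℕ} {K : Finset (Finset ℕ)} (e : {e // e ∈ edges K}) :
    Fin (n + 5) ⊕ {F // F ∈ K} → Prop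
  | .inl a => a.1 ∈ e.1
  | .inr F => e.1 ⊆ F.1

theorem ncard_le_card_of_injective {α β : Type*} {S : Set α} {f : α → β}
    (hf : Function.Injective f) (t : Finset β) (h : ∀ x ∈ S, f x ∈ t) : S.ncard ≤ t.card := by
  rw [← Set.ncard_coe_finset t]
  exact Set.ncard_le_ncard_of_injOn f h hf.injOn

theorem eq_pair_of_mem {e : Finset ℕ} (he : e.card = 2) {a b : ℕ} (ha : a ∈ e) (hb : b ∈ e)
    (hab : a ≠ b) : e = {a, b} := by
  symm
  apply Finset.eq_of_subset_of_card_le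
  · intro c hc
    simp only [Finset.mem_insert, Finset.mem_singleton] at hc
    rcases hc with rfl | rfl <;> assumption
  · rw [Finset.card_pair hab, he]

section

variable {n : ℕ} {K : Finset (Finset ℕ)}

theorem card_of_mem_edges {e : Finset ℕ} (he : e ∈ edges K) : e.card = 2 := by
  obtain ⟨F, -, -, h⟩ := mem_edges.1 he
  exact h

theorem pair_mem_edges {F : Finset ℕ} (hF : F ∈ K) {a b : ℕ} (ha : a ∈ F) (hb : b ∈ F)
    (hab : a ≠ b) : {a, b} ∈ edges K := by
  refine mem_edges.2 ⟨F, hF, ?_, Finset.card_pair hab⟩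
  intro c hc
  simp only [Finset.mem_insert, Finset.mem_singleton] at hc
  rcases hc with rfl | rfl <;> assumption

theorem SphereLike.eq_of_subset (hK : SphereLike n K) {F G : Finset ℕ} (hF : F ∈ K) (hG : G ∈ K)
    (h : F ⊆ G) : F = G :=
  Finset.eq_of_subset_of_card_le h (by rw [hK.card_facet F hF, hK.card_facet G hG])

theorem SphereLike.exists_facet (hK : SphereLike n K) {i : ℕ} (hi : i < n + 5) :
    ∃ F ∈ K, i ∈ F := by
  obtain ⟨e, he, hie, -⟩ := hK.exists_edge i hi
  obtain ⟨F, hF, heF, -⟩ := mem_edges.1 he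
  exact ⟨F, hF, heF hie⟩

/-- Two vertices have at most one edge in common, a vertex of `F` is on three edges of `F`, and two
facets meet in at most three vertices, which span at most three edges. -/
theorem SphereLike.ncard_facet_inter_le (hK : SphereLike n K)
    (k k' : Fin (n + 5) ⊕ {F // F ∈ K}) (hkk : k ≠ k') :
    {e : {e // e ∈ edges K} | Incident e k ∧ Incident e k'}.ncard ≤ 3 := by
  have mixed : ∀ (a : Fin (n + 5)) (F : {F // F ∈ K}),
      {e : {e // e ∈ edges K} | Incident e (.inl a) ∧ Incident (n := n) e (.inr F)}.ncard ≤ 3 := by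
    intro a F
    -- The constant filter predicate makes the set empty when `a` is not a vertex of `F`.
    have : {e : {e // e ∈ edges K} | Incident e (.inl a) ∧ Incident (n := n) e (.inr F)}.ncard ≤
        (((F.1.filter fun _ => a.1 ∈ F.1).erase a.1).image fun c => ({a.1, c} : Finset ℕ)).card := by
      refine ncard_le_card_of_injective Subtype.val_injective _ ?_
      rintro e ⟨hae, heF⟩
      have hae : a.1 ∈ e.1 := hae
      have heF : e.1 ⊆ F.1 := heF
      obtain ⟨c, hc, hca⟩ := Finset.exists_mem_ne
        (by rw [card_of_mem_edges e.2]; omega : 1 < e.1.card) a.1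
      exact Finset.mem_image.2 ⟨c, Finset.mem_erase.2 ⟨hca, Finset.mem_filter.2
        ⟨heF hc, heF hae⟩⟩, (eq_pair_of_mem (card_of_mem_edges e.2) hae hc hca.symm).symm⟩
    refine this.trans (Finset.card_image_le.trans ?_)
    by_cases haF : a.1 ∈ F.1
    · rw [Finset.filter_true_of_mem fun _ _ => haF, Finset.card_erase_of_mem haF,
        hK.card_facet F.1 F.2]
    · rw [Finset.filter_false_of_mem fun _ _ => haF]; simp
  rcases k with a | F <;> rcases k' with b | G
  · have hab : a.1 ≠ b.1 := fun h => hkk (congrArg _ (Fin.ext h))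
    refine (ncard_le_card_of_injective Subtype.val_injective {{a.1, b.1}} ?_).trans (by simp)
    rintro e ⟨hae, hbe⟩
    exact Finset.mem_singleton.2 (eq_pair_of_mem (card_of_mem_edges e.2) hae hbe hab)
  · exact mixed a G
  · simpa only [and_comm] using mixed b F
  · have hFG : F.1 ≠ G.1 := fun h => hkk (congrArg _ (Subtype.ext h))
    refine (ncard_le_card_of_injective Subtype.val_injective
      (Finset.powersetCard 2 (F.1 ∩ G.1)) ?_).trans ?_
    · rintro e ⟨heF, heG⟩
      exact Finset.mem_powersetCard.2 ⟨Finset.subset_inter heF heG, card_of_mem_edges e.2⟩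
    · have : (F.1 ∩ G.1).card < 4 := by
        rw [← hK.card_facet F.1 F.2]
        apply Finset.card_lt_card
        refine Finset.ssubset_iff_subset_ne.2 ⟨Finset.inter_subset_left, fun h => hFG ?_⟩
        exact hK.eq_of_subset F.2 G.2 (Finset.inter_eq_left.1 h)
      rw [Finset.card_powersetCard]
      exact (Nat.choose_le_choose 2 (by omega : (F.1 ∩ G.1).card ≤ 3)).trans (by decide)

/-- Distinct edges share at most one vertex, and their union contains three vertices, which lie
together in at most two facets: `1 + 2 = 3`. -/
theorem SphereLike.ncard_vertex_inter_le (hK : SphereLike n K)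
    (e e' : {e // e ∈ edges K}) (hee : e ≠ e') :
    {k : Fin (n + 5) ⊕ {F // F ∈ K} | Incident e k ∧ Incident e' k}.ncard ≤ 3 := by
  have h2 := card_of_mem_edges e.2
  have h2' := card_of_mem_edges e'.2
  have hinter : (e.1 ∩ e'.1).card < 2 := by
    rw [← h2]
    apply Finset.card_lt_card
    refine Finset.ssubset_iff_subset_ne.2 ⟨Finset.inter_subset_left, fun h => hee ?_⟩
    exact Subtype.ext (Finset.eq_of_subset_of_card_le (Finset.inter_eq_left.1 h) (by omega))
  have hunion := Finset.card_union_add_card_inter e.1 e'.1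
  obtain ⟨T, hT, hT3⟩ := Finset.exists_subset_card_eq (by omega : 3 ≤ (e.1 ∪ e'.1).card)
  have hf : Function.Injective (Sum.map (fun a : Fin (n + 5) => a.1) fun F : {F // F ∈ K} => F.1) :=
    Sum.map_injective.2 ⟨Fin.val_injective, Subtype.val_injective⟩
  refine (ncard_le_card_of_injective hf
    ((e.1 ∩ e'.1).disjSum (K.filter (T ⊆ ·))) ?_).trans ?_
  · rintro (a | F) ⟨h, h'⟩
    · exact Finset.inl_mem_disjSum.2 (Finset.mem_inter.2 ⟨h, h'⟩)
    · exact Finset.inr_mem_disjSum.2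
        (Finset.mem_filter.2 ⟨F.2, hT.trans (Finset.union_subset h h')⟩)
  · rw [Finset.card_disjSum]
    have := hK.triangle_le T hT3
    omega

theorem eq_of_forall_incident {e e' : {e // e ∈ edges K}} (hK : SphereLike n K)
    (h : ∀ k : Fin (n + 5) ⊕ {F // F ∈ K}, Incident e k → Incident e' k) : e = e' := by
  apply Subtype.ext
  apply Finset.eq_of_subset_of_card_le
  · intro a ha
    have := Finset.mem_range.1 (hK.edge_subset e.2 ha)
    exact h (.inl ⟨a, this⟩) ha
  · rw [card_of_mem_edges e.2, card_of_mem_edges e'.2]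

theorem SphereLike.exists_incident (hK : SphereLike n K) (k : Fin (n + 5) ⊕ {F // F ∈ K}) :
    ∃ e : {e // e ∈ edges K}, Incident e k := by
  rcases k with a | F
  · obtain ⟨e, he, hae, -⟩ := hK.exists_edge a.1 a.2
    exact ⟨⟨e, he⟩, hae⟩
  · obtain ⟨e, he, hc⟩ := Finset.exists_subset_card_eq
      (by rw [hK.card_facet F.1 F.2]; omega : 2 ≤ F.1.card)
    exact ⟨⟨e, mem_edges.2 ⟨F.1, F.2, he, hc⟩⟩, he⟩

theorem SphereLike.eq_of_forall_incident (hK : SphereLike n K)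
    {k k' : Fin (n + 5) ⊕ {F // F ∈ K}}
    (h : ∀ e : {e // e ∈ edges K}, Incident e k → Incident e k') : k = k' := by
  have subset_of : ∀ (a : ℕ) (F : Finset ℕ) (G : {F // F ∈ K}), F ∈ K → a ∈ F →
      (∀ e : {e // e ∈ edges K}, a ∈ e.1 → e.1 ⊆ F → e.1 ⊆ G.1) → F = G.1 := by
    intro a F G hF ha hG
    refine hK.eq_of_subset hF G.2 fun c hc => ?_
    by_cases hca : c = a
    · obtain ⟨b, hb, hba⟩ := Finset.exists_mem_ne
        (by rw [hK.card_facet F hF]; omega : 1 < F.card) a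
      subst hca
      refine hG ⟨{c, b}, pair_mem_edges hF ha hb hba.symm⟩ (by simp) ?_ (by simp)
      intro d hd
      simp only [Finset.mem_insert, Finset.mem_singleton] at hd
      rcases hd with rfl | rfl <;> assumption
    · refine hG ⟨{a, c}, pair_mem_edges hF ha hc (Ne.symm hca)⟩ (by simp) ?_ (by simp)
      intro d hd
      simp only [Finset.mem_insert, Finset.mem_singleton] at hd
      rcases hd with rfl | rfl <;> assumption
  rcases k with a | F <;> rcases k' with b | G
  · by_contra hab
    obtain ⟨F, hF, haF⟩ := hK.exists_facet a.2
    obtain ⟨c, hc, hcb⟩ := Finset.exists_mem_ne (s := F.erase a.1)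
      (by rw [Finset.card_erase_of_mem haF, hK.card_facet F hF]; omega) b.1
    rw [Finset.mem_erase] at hc
    have : b.1 ∈ ({a.1, c} : Finset ℕ) :=
      h ⟨{a.1, c}, pair_mem_edges hF haF hc.2 hc.1.symm⟩ (by simp [Incident])
    simp only [Finset.mem_insert, Finset.mem_singleton] at this
    rcases this with h | h
    · exact hab (congrArg _ (Fin.ext h.symm))
    · exact hcb h.symm
  · exfalso
    obtain ⟨F, hF, haF⟩ := hK.exists_facet a.2
    obtain ⟨c, hc, hca⟩ := Finset.exists_mem_ne
      (by rw [hK.card_facet F hF]; omega : 1 < F.card) a.1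
    -- If all edges at `a` were contained in `G`, two different facets through `a` would both equal
    -- `G`.
    obtain ⟨H, hH, hHF, hsub⟩ := hK.closed F hF c hc
    have h1 := subset_of a.1 F G hF haF fun e he _ => h e he
    have h2 := subset_of a.1 H G hH (hsub (Finset.mem_erase.2 ⟨hca.symm, haF⟩))
      fun e he _ => h e he
    exact hHF (h2.trans h1.symm)
  · exfalso
    obtain ⟨e, he, hc⟩ := Finset.exists_subset_card_eq (s := F.1.erase b.1) (n := 2)
      (by have := Finset.pred_card_le_card_erase (s := F.1) (a := b.1)
          rw [hK.card_facet F.1 F.2] at this; omega)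
    have heF : e ⊆ F.1 := he.trans (Finset.erase_subset _ _)
    have : b.1 ∈ e := h ⟨e, mem_edges.2 ⟨F.1, F.2, heF, hc⟩⟩ heF
    exact Finset.notMem_erase _ _ (he this)
  · obtain ⟨a, ha⟩ : F.1.Nonempty := Finset.card_pos.1 (by rw [hK.card_facet F.1 F.2]; omega)
    exact congrArg _ (Subtype.ext (subset_of a F.1 G F.2 ha fun e _ he => h e he))

/-! ### Recovering the sphere from the incidences -/

/-- The facets that meet the facet `k` in a set of vertices that contains `e` and another
vertex. -/
def adjacentAt {ι κ : Type*} (I : ι → κ → Prop) (e : ι) (k : κ) : Set κ :=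
  {k' | k' ≠ k ∧ I e k' ∧ ∃ e', e' ≠ e ∧ I e' k ∧ I e' k'}

theorem ncard_adjacentAt_equiv {ι κ ι' κ' : Type*} {I : ι → κ → Prop} {I' : ι' → κ' → Prop}
    (φ : ι ≃ ι') (ψ : κ ≃ κ') (h : ∀ e k, I e k ↔ I' (φ e) (ψ k)) (e : ι) (k : κ) :
    (adjacentAt I' (φ e) (ψ k)).ncard = (adjacentAt I e k).ncard := by
  rw [← Set.ncard_image_of_injective (adjacentAt I e k) ψ.injective]
  congr 1
  ext k'
  obtain ⟨k', rfl⟩ := ψ.surjective k'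
  rw [ψ.injective.mem_set_image]
  simp only [adjacentAt, Set.mem_ofPred_eq, h, ψ.injective.ne_iff]
  refine and_congr_right fun _ => and_congr_right fun _ => ?_
  constructor
  · rintro ⟨e', he', h1, h2⟩
    obtain ⟨e', rfl⟩ := φ.surjective e'
    exact ⟨e', fun h => he' (h ▸ rfl), h1, h2⟩
  · rintro ⟨e', he', h1, h2⟩
    exact ⟨φ e', φ.injective.ne he', h1, h2⟩

/-- At the vertex `{a, b}` of the octahedron of `F` there are at least four adjacent facets: those
of `a` and `b`, and the neighbours of `F` across its two triangles through `{a, b}`. In the facet of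
a vertex, the adjacent facets at `e` come from facets of `K` containing `e`, of which there are at
most three for a suitable `e`. -/
theorem SphereLike.isLeft_iff (hK : SphereLike n K) (k : Fin (n + 5) ⊕ {F // F ∈ K}) :
    k.isLeft ↔ ∃ e : {e // e ∈ edges K}, Incident e k ∧ (adjacentAt Incident e k).ncard ≤ 3 := by
  rcases k with a | F
  · simp only [Sum.isLeft_inl, true_iff]
    obtain ⟨e, he, hae, hdeg⟩ := hK.exists_edge a.1 a.2
    refine ⟨⟨e, he⟩, hae, le_trans ?_ hdeg⟩
    have hf : Function.Injective
        (Sum.map (fun a : Fin (n + 5) => a.1) fun F : {F // F ∈ K} => F.1) :=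
      Sum.map_injective.2 ⟨Fin.val_injective, Subtype.val_injective⟩
    rw [← Finset.card_map Function.Embedding.inr (s := K.filter (e ⊆ ·))]
    refine ncard_le_card_of_injective hf _ ?_
    rintro (b | F) ⟨hne, hbe, e', he', hae', hbe'⟩
    · exfalso
      have hab : a.1 ≠ b.1 := fun h => hne (congrArg _ (Fin.ext h.symm))
      apply he'
      apply Subtype.ext
      exact (eq_pair_of_mem (card_of_mem_edges e'.2) hae' hbe' hab).trans
        (eq_pair_of_mem (card_of_mem_edges he) hae hbe hab).symm
    · refine Finset.mem_map.2 ⟨F.1, Finset.mem_filter.2 ⟨F.2, hbe⟩, rfl⟩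
  · simp only [Sum.isLeft_inr, Bool.false_eq_true, false_iff, not_exists, not_and, not_le]
    rintro ⟨e, he⟩ heF
    have heF : e ⊆ F.1 := heF
    have h4 := hK.card_facet F.1 F.2
    obtain ⟨a, b, hab, rfl⟩ := Finset.card_eq_two.1 (card_of_mem_edges he)
    have haF : a ∈ F.1 := heF (by simp)
    have hbF : b ∈ F.1 := heF (by simp)
    have hrest : (F.1 \ {a, b}).card = 2 := by
      rw [Finset.card_sdiff_of_subset heF, h4, Finset.card_pair hab]
    obtain ⟨c, d, hcd, hrest⟩ := Finset.card_eq_two.1 hrest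
    have hc : c ∈ F.1 \ {a, b} := by rw [hrest]; simp
    have hd : d ∈ F.1 \ {a, b} := by rw [hrest]; simp
    simp only [Finset.mem_sdiff, Finset.mem_insert, Finset.mem_singleton, not_or] at hc hd
    obtain ⟨hcF, hca, hcb⟩ := hc
    obtain ⟨hdF, hda, hdb⟩ := hd
    obtain ⟨G, hG, hGF, hGsub⟩ := hK.closed F.1 F.2 c hcF
    obtain ⟨H, hH, hHF, hHsub⟩ := hK.closed F.1 F.2 d hdF
    have hGH : G ≠ H := by
      rintro rfl
      apply hGF
      symm
      refine hK.eq_of_subset F.2 hG fun x hx => ?_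
      by_cases hxc : x = c
      · exact hHsub (Finset.mem_erase.2 ⟨hxc ▸ hcd, hx⟩)
      · exact hGsub (Finset.mem_erase.2 ⟨hxc, hx⟩)
    have pair : ∀ {x y : ℕ} {G : Finset ℕ}, x ∈ G → y ∈ G → ({x, y} : Finset ℕ) ⊆ G := by
      intro x y G hx hy z hz
      simp only [Finset.mem_insert, Finset.mem_singleton] at hz
      rcases hz with rfl | rfl <;> assumption
    have han := Finset.mem_range.1 (hK.facet_subset F.1 F.2 haF)
    have hbn := Finset.mem_range.1 (hK.facet_subset F.1 F.2 hbF)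
    have inG : ∀ {x}, x ∈ F.1 → x ≠ c → x ∈ G := fun hx hxc =>
      hGsub (Finset.mem_erase.2 ⟨hxc, hx⟩)
    have inH : ∀ {x}, x ∈ F.1 → x ≠ d → x ∈ H := fun hx hxd =>
      hHsub (Finset.mem_erase.2 ⟨hxd, hx⟩)
    have pne : ∀ {x y}, x ≠ a → x ≠ b → ({y, x} : Finset ℕ) ≠ {a, b} := by
      intro x y hxa hxb h
      have : x ∈ ({a, b} : Finset ℕ) := by rw [← h]; simp
      simp only [Finset.mem_insert, Finset.mem_singleton] at this
      tauto
    have hsub : ({.inl ⟨a, han⟩, .inl ⟨b, hbn⟩, .inr ⟨G, hG⟩, .inr ⟨H, hH⟩} :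
        Finset (Fin (n + 5) ⊕ {F // F ∈ K})) ≤
        (Set.toFinite (adjacentAt Incident ⟨{a, b}, he⟩ (.inr F))).toFinset := by
      intro k hk
      rw [Set.Finite.mem_toFinset]
      simp only [Finset.mem_insert, Finset.mem_singleton] at hk
      rcases hk with rfl | rfl | rfl | rfl
      · exact ⟨by simp, by simp [Incident], ⟨{a, c}, pair_mem_edges F.2 haF hcF (Ne.symm hca)⟩,
          fun h => pne hca hcb (congrArg Subtype.val h), pair haF hcF, by simp [Incident]⟩
      · exact ⟨by simp, by simp [Incident], ⟨{b, c}, pair_mem_edges F.2 hbF hcF (Ne.symm hcb)⟩,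
          fun h => pne hca hcb (congrArg Subtype.val h), pair hbF hcF, by simp [Incident]⟩
      · exact ⟨fun h => hGF (congrArg Subtype.val (Sum.inr_injective h)),
          pair (inG haF (Ne.symm hca)) (inG hbF (Ne.symm hcb)),
          ⟨{a, d}, pair_mem_edges F.2 haF hdF (Ne.symm hda)⟩,
          fun h => pne hda hdb (congrArg Subtype.val h), pair haF hdF,
          pair (inG haF (Ne.symm hca)) (inG hdF (Ne.symm hcd))⟩
      · exact ⟨fun h => hHF (congrArg Subtype.val (Sum.inr_injective h)),
          pair (inH haF (Ne.symm hda)) (inH hbF (Ne.symm hdb)),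
          ⟨{a, c}, pair_mem_edges F.2 haF hcF (Ne.symm hca)⟩,
          fun h => pne hca hcb (congrArg Subtype.val h), pair haF hcF,
          pair (inH haF (Ne.symm hda)) (inH hcF hcd)⟩
    have hcard := Finset.card_le_card hsub
    rw [← Set.ncard_eq_toFinset_card] at hcard
    have : ({.inl ⟨a, han⟩, .inl ⟨b, hbn⟩, .inr ⟨G, hG⟩, .inr ⟨H, hH⟩} :
        Finset (Fin (n + 5) ⊕ {F // F ∈ K})).card = 4 := by
      rw [Finset.card_insert_of_notMem, Finset.card_insert_of_notMem,
        Finset.card_insert_of_notMem, Finset.card_singleton]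
      · simpa using hGH
      · simp
      · simpa using hab
    omega

/-- The action of a permutation of the vertices on the natural numbers. -/
def relabel {m : ℕ} (π : Equiv.Perm (Fin m)) (i : ℕ) : ℕ :=
  if h : i < m then π ⟨i, h⟩ else i

theorem relabel_of_lt {m : ℕ} (π : Equiv.Perm (Fin m)) {i : ℕ} (h : i < m) :
    relabel π i = π ⟨i, h⟩ := dif_pos h

theorem relabel_injOn {m : ℕ} (π : Equiv.Perm (Fin m)) :
    Set.InjOn (relabel π) (Set.Iio m) := by
  intro i hi j hj h
  rw [relabel_of_lt π hi, relabel_of_lt π hj] at h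
  exact congrArg Fin.val (π.injective (Fin.ext h))

/-- Stacked spheres with isomorphic rectifications differ by a permutation of the vertices. -/
theorem exists_relabel_of_incidence_equiv {L : Finset (Finset ℕ)} (hK : SphereLike n K)
    (hL : SphereLike n L) (φ : {e // e ∈ edges K} ≃ {e // e ∈ edges L})
    (ψ : Fin (n + 5) ⊕ {F // F ∈ K} ≃ Fin (n + 5) ⊕ {F // F ∈ L})
    (h : ∀ e k, Incident e k ↔ Incident (φ e) (ψ k)) :
    ∃ π : Equiv.Perm (Fin (n + 5)), K.image (Finset.image (relabel π)) = L := by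
  have hleft : ∀ k, (ψ k).isLeft ↔ k.isLeft := by
    intro k
    rw [hK.isLeft_iff, hL.isLeft_iff]
    constructor
    · rintro ⟨e, he, hc⟩
      obtain ⟨e, rfl⟩ := φ.surjective e
      exact ⟨e, (h e k).2 he, by rwa [ncard_adjacentAt_equiv φ ψ h] at hc⟩
    · rintro ⟨e, he, hc⟩
      exact ⟨φ e, (h e k).1 he, by rwa [ncard_adjacentAt_equiv φ ψ h]⟩
  have hv : ∀ a, ∃ b, ψ (.inl a) = .inl b := fun a => by
    have := (hleft (.inl a)).2 rfl
    exact Sum.isLeft_iff.1 this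
  have hf : ∀ F, ∃ G, ψ (.inr F) = .inr G := fun F => by
    rw [← Sum.isRight_iff, ← Sum.not_isLeft, hleft]
    simp
  choose p hp using hv
  have hpinj : Function.Injective p := fun a b hab =>
    Sum.inl_injective (ψ.injective (by rw [hp, hp, hab]))
  let π : Equiv.Perm (Fin (n + 5)) := Equiv.ofBijective p (Finite.injective_iff_bijective.1 hpinj)
  have hlt : ∀ F ∈ K, ∀ a ∈ F, a < n + 5 := fun F hF a ha =>
    Finset.mem_range.1 (hK.facet_subset F hF ha)
  have himage : ∀ F ∈ K, F.image (relabel π) ∈ L := by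
    intro F hF
    obtain ⟨G, hG⟩ := hf ⟨F, hF⟩
    -- For `a ∈ F` and an edge `e` of `F` at `a`, the image edge `φ e` contains `p a` and is
    -- contained in `G`, so `p a ∈ G`.
    have : F.image (relabel π) = G.1 := by
      apply Finset.eq_of_subset_of_card_le
      · intro b hb
        obtain ⟨a, ha, rfl⟩ := Finset.mem_image.1 hb
        obtain ⟨c, hc, hca⟩ := Finset.exists_mem_ne
          (by rw [hK.card_facet F hF]; omega : 1 < F.card) a
        have han := hlt F hF a ha
        let e : {e // e ∈ edges K} := ⟨{a, c}, pair_mem_edges hF ha hc hca.symm⟩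
        have h1 : Incident (φ e) (ψ (.inl ⟨a, han⟩)) :=
          (h e _).1 (by simp [Incident, e])
        have h2 : Incident (φ e) (ψ (.inr ⟨F, hF⟩)) := by
          refine (h e _).1 ?_
          intro d hd
          simp only [e, Finset.mem_insert, Finset.mem_singleton] at hd
          rcases hd with rfl | rfl <;> assumption
        rw [hp] at h1
        rw [hG] at h2
        rw [relabel_of_lt π han]
        exact h2 h1
      · rw [Finset.card_image_of_injOn ((relabel_injOn π).mono fun a ha => hlt F hF a ha),
          hK.card_facet F hF, hL.card_facet G.1 G.2]
    rw [this]; exact G.2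
  refine ⟨π, Finset.eq_of_subset_of_card_le ?_ ?_⟩
  · intro G hG
    obtain ⟨F, hF, rfl⟩ := Finset.mem_image.1 hG
    exact himage F hF
  · rw [Finset.card_image_of_injOn, hK.card_eq, hL.card_eq]
    intro F hF G hG hFG
    refine hK.eq_of_subset hF hG fun a ha => ?_
    have : relabel π a ∈ G.image (relabel π) := by
      rw [← hFG]; exact Finset.mem_image_of_mem _ ha
    obtain ⟨b, hb, hab⟩ := Finset.mem_image.1 this
    exact relabel_injOn π (hlt G hG b hb) (hlt F hF a ha) hab ▸ hb

end

/-! ### Frames -/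

/-- The homogenization of Euclidean four-space. -/
abbrev Homog : Type := EuclideanSpace ℝ (Fin 4) × ℝ

/-- A sum of multiples of vectors `v i` lies in a cone that contains the sums of pairs of these
vectors, if no coefficient exceeds the sum of the others. -/
theorem sum_smul_mem_of_two_mul_le {V : Type*} [AddCommGroup V] [Module ℝ V]
    (C : PointedCone ℝ V) (v : ℕ → V) (s : Finset ℕ) (hs : 3 ≤ s.card)
    (hC : ∀ i ∈ s, ∀ j ∈ s, i ≠ j → v i + v j ∈ C) (α : ℕ → ℝ) (h0 : ∀ i ∈ s, 0 ≤ α i)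
    (hle : ∀ i ∈ s, 2 * α i ≤ ∑ j ∈ s, α j) : ∑ i ∈ s, α i • v i ∈ C := by
  have hsmul : ∀ (r : ℝ) (z : V), 0 ≤ r → z ∈ C → r • z ∈ C :=
    fun r z hr hz => C.smul_mem hr hz
  obtain ⟨k, hk⟩ : ∃ k, s.card = k + 3 := ⟨s.card - 3, by omega⟩
  clear hs
  induction k generalizing s α with
  | zero =>
    obtain ⟨a, b, c, hab, hac, hbc, rfl⟩ := Finset.card_eq_three.1 hk
    have hsum : ∑ i ∈ ({a, b, c} : Finset ℕ), α i = α a + (α b + α c) := by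
      rw [Finset.sum_insert (by simp [hab, hac]), Finset.sum_pair hbc]
    have ha := hle a (by simp)
    have hb := hle b (by simp)
    have hc := hle c (by simp)
    rw [hsum] at ha hb hc
    rw [Finset.sum_insert (by simp [hab, hac]), Finset.sum_pair hbc]
    -- The coefficients are determined by the three equations; their signs are the triangle
    -- inequalities.
    have e : α a • v a + (α b • v b + α c • v c) =
        ((α a + α b - α c) / 2) • (v a + v b) + (((α a + α c - α b) / 2) • (v a + v c) +
          ((α b + α c - α a) / 2) • (v b + v c)) := by module
    rw [e]
    refine add_mem (hsmul _ _ (by linarith) (hC a (by simp) b (by simp) hab))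
      (add_mem (hsmul _ _ (by linarith) (hC a (by simp) c (by simp) hac))
        (hsmul _ _ (by linarith) (hC b (by simp) c (by simp) hbc)))
  | succ k ih =>
    -- Splitting off `α m • (v m + v M)`, with `α m` least and `α M` greatest among the rest,
    -- removes the index `m` and keeps the hypotheses.
    obtain ⟨m, hm, hmin⟩ := s.exists_min_image α (Finset.card_pos.1 (by omega))
    have hcard : (s.erase m).card = k + 3 := by rw [Finset.card_erase_of_mem hm]; omega
    obtain ⟨M, hM, hmax⟩ := (s.erase m).exists_max_image α (Finset.card_pos.1 (by omega))
    have hMs : M ∈ s := Finset.mem_of_mem_erase hM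
    have hMm : M ≠ m := Finset.ne_of_mem_erase hM
    set β : ℕ → ℝ := Function.update α M (α M - α m) with hβ
    have hβM : β M = α M - α m := Function.update_self ..
    have hβne : ∀ i, i ≠ M → β i = α i := fun i hi => Function.update_of_ne hi ..
    have hrest : ∑ i ∈ (s.erase m).erase M, β i • v i = ∑ i ∈ (s.erase m).erase M, α i • v i :=
      Finset.sum_congr rfl fun i hi => by rw [hβne i (Finset.ne_of_mem_erase hi)]
    have hrest' : ∑ i ∈ (s.erase m).erase M, β i = ∑ i ∈ (s.erase m).erase M, α i :=
      Finset.sum_congr rfl fun i hi => by rw [hβne i (Finset.ne_of_mem_erase hi)]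
    have e : ∑ i ∈ s, α i • v i = α m • (v m + v M) + ∑ i ∈ s.erase m, β i • v i := by
      rw [← Finset.add_sum_erase s _ hm, ← Finset.add_sum_erase _ _ hM,
        ← Finset.add_sum_erase (s.erase m) (fun i => β i • v i) hM, hrest, hβM]
      module
    have e' : ∑ i ∈ s.erase m, β i = ∑ i ∈ s, α i - 2 * α m := by
      rw [← Finset.add_sum_erase s α hm, ← Finset.add_sum_erase _ α hM,
        ← Finset.add_sum_erase (s.erase m) β hM, hrest', hβM]
      ring
    rw [e]
    refine add_mem (hsmul _ _ (h0 m hm) (hC m hm M hMs hMm.symm)) (ih (s.erase m)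
      (fun i hi j hj => hC i (Finset.mem_of_mem_erase hi) j (Finset.mem_of_mem_erase hj)) β ?_ ?_
      hcard)
    · intro i hi
      by_cases hiM : i = M
      · rw [hiM, hβM]; linarith [hmin M hMs]
      · rw [hβne i hiM]; exact h0 i (Finset.mem_of_mem_erase hi)
    · intro i hi
      rw [e']
      by_cases hiM : i = M
      · rw [hiM, hβM]; linarith [hle M hMs]
      · rw [hβne i hiM]
        have hi' : i ∈ (s.erase m).erase M := Finset.mem_erase.2 ⟨hiM, hi⟩
        -- A fourth index `l` exists; then `α M ≥ α i` and `α l ≥ α m` give the bound for the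
        -- reduced sum.
        obtain ⟨l, hl⟩ : (((s.erase m).erase M).erase i).Nonempty := by
          rw [← Finset.card_pos, Finset.card_erase_of_mem hi', Finset.card_erase_of_mem hM]
          omega
        have hls : l ∈ s := by
          simp only [Finset.mem_erase] at hl; exact hl.2.2.2
        have h3 : 0 ≤ ∑ j ∈ (((s.erase m).erase M).erase i).erase l, α j :=
          Finset.sum_nonneg fun j hj => h0 j (by simp only [Finset.mem_erase] at hj; tauto)
        rw [← Finset.add_sum_erase s _ hm, ← Finset.add_sum_erase _ _ hM,
          ← Finset.add_sum_erase _ _ hi', ← Finset.add_sum_erase _ _ hl]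
        linarith [hmin l hls, hmax i hi]

/-- The functionals `B i` are dual to the five vectors `v i` with `i ∈ T`, and `h i` for `i ∈ T`
is the functional that is `1` at `v i` and `-1` at the other vectors. -/
structure IsFrame (v : ℕ → Homog) (h : ℕ → Homog →ₗ[ℝ] ℝ) (T : Finset ℕ)
    (B : ℕ → Homog →ₗ[ℝ] ℝ) : Prop where
  card : T.card = 5
  dual : ∀ i ∈ T, ∀ j ∈ T, B i (v j) = if i = j then 1 else 0
  expand : ∀ z, ∑ i ∈ T, B i z • v i = z
  normal : ∀ i ∈ T, ∀ j ∈ T, h i (v j) = if i = j then 1 else -1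

/-- The vertex of the rectification on the edge `e`, in homogeneous coordinates. -/
def edgePoint (v : ℕ → Homog) (e : Finset ℕ) : Homog := ∑ i ∈ e, v i

theorem edgePoint_pair (v : ℕ → Homog) {a b : ℕ} (hab : a ≠ b) :
    edgePoint v {a, b} = v a + v b := Finset.sum_pair hab

theorem edgePoint_congr {v v' : ℕ → Homog} {e : Finset ℕ} (h : ∀ i ∈ e, v i = v' i) :
    edgePoint v e = edgePoint v' e := Finset.sum_congr rfl h

namespace IsFrame

variable {v : ℕ → Homog} {h : ℕ → Homog →ₗ[ℝ] ℝ} {T : Finset ℕ} {B : ℕ → Homog →ₗ[ℝ] ℝ}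

theorem congr {v' : ℕ → Homog} {h' : ℕ → Homog →ₗ[ℝ] ℝ} (hf : IsFrame v h T B)
    (hv : ∀ i ∈ T, v' i = v i) (hh : ∀ i ∈ T, h' i = h i) : IsFrame v' h' T B where
  card := hf.card
  dual i hi j hj := by rw [hv j hj, hf.dual i hi j hj]
  expand z := by
    conv_rhs => rw [← hf.expand z]
    exact Finset.sum_congr rfl fun i hi => by rw [hv i hi]
  normal i hi j hj := by rw [hv j hj, hh i hi, hf.normal i hi j hj]

theorem dual_edgePoint (hf : IsFrame v h T B) {i : ℕ} (hi : i ∈ T) {e : Finset ℕ} (he : e ⊆ T) :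
    B i (edgePoint v e) = if i ∈ e then 1 else 0 := by
  rw [edgePoint, map_sum, Finset.sum_congr rfl fun j hj => hf.dual i hi j (he hj)]
  simp

theorem apply_eq (hf : IsFrame v h T B) {i : ℕ} (hi : i ∈ T) (z : Homog) :
    h i z = 2 * B i z - ∑ j ∈ T, B j z := by
  conv_lhs => rw [← hf.expand z, map_sum]
  have : ∀ j ∈ T, h i (B j z • v j) = (if i = j then 2 * B j z else 0) - B j z := fun j hj => by
    rw [map_smul, hf.normal i hi j hj, smul_eq_mul]
    split_ifs <;> ring
  rw [Finset.sum_congr rfl this, Finset.sum_sub_distrib, Finset.sum_ite_eq, if_pos hi]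

theorem normal_edgePoint (hf : IsFrame v h T B) {i : ℕ} (hi : i ∈ T) {e : Finset ℕ} (he : e ⊆ T)
    (hc : e.card = 2) : h i (edgePoint v e) = if i ∈ e then 0 else -2 := by
  have : ∑ j ∈ T, B j (edgePoint v e) = 2 := by
    rw [Finset.sum_congr rfl fun j hj => hf.dual_edgePoint hj he, Finset.sum_ite_mem,
      Finset.inter_eq_right.2 he, Finset.sum_const, hc]
    norm_num
  rw [hf.apply_eq hi, this, hf.dual_edgePoint hi he]
  split_ifs <;> norm_num

/-- This is the cone over a hypersimplex: by `apply_eq`, `h i z ≤ 0` says that the coordinate `B i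
z` is at most the sum of the others. -/
theorem mem_cone (hf : IsFrame v h T B) (C : PointedCone ℝ Homog)
    (hC : ∀ i ∈ T, ∀ j ∈ T, i ≠ j → v i + v j ∈ C) {z : Homog} (hB : ∀ i ∈ T, 0 ≤ B i z)
    (hh : ∀ i ∈ T, h i z ≤ 0) : z ∈ C := by
  rw [← hf.expand z]
  refine sum_smul_mem_of_two_mul_le C v T (by rw [hf.card]; norm_num) hC (fun i => B i z) hB
    fun i hi => ?_
  have := hh i hi
  rw [hf.apply_eq hi] at this
  linarith

end IsFrame

/-! ### The frame of a new simplex -/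

/-- The apex of a flat simplex over the facet `F` of a simplex with opposite vertex `y`. -/
noncomputable def apex (v : ℕ → Homog) (F : Finset ℕ) (y : ℕ) (t : ℝ) : Homog :=
  ((1 + t) / 2) • ∑ i ∈ F, v i - t • v y

/-- The coordinate functionals of the new simplex. -/
noncomputable def newDual (B : ℕ → Homog →ₗ[ℝ] ℝ) (y x : ℕ) (t : ℝ) (i : ℕ) : Homog →ₗ[ℝ] ℝ :=
  if i = x then -(t⁻¹ • B y) else B i + ((1 + t) / (2 * t)) • B y

/-- The functional of the facet that cuts off the new apex. -/
noncomputable def newNormal (B : ℕ → Homog →ₗ[ℝ] ℝ) (F : Finset ℕ) (y x : ℕ) (t : ℝ) :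
    Homog →ₗ[ℝ] ℝ :=
  newDual B y x t x - ∑ i ∈ F, newDual B y x t i

section NewFrame

variable {v : ℕ → Homog} {h : ℕ → Homog →ₗ[ℝ] ℝ} {T : Finset ℕ} {B : ℕ → Homog →ₗ[ℝ] ℝ}
  {x y : ℕ} {t : ℝ}

theorem newDual_self (z : Homog) : newDual B y x t x z = -(t⁻¹ * B y z) := by
  simp [newDual]

theorem newDual_of_ne {i : ℕ} (hi : i ≠ x) (z : Homog) :
    newDual B y x t i z = B i z + (1 + t) / (2 * t) * B y z := by
  simp [newDual, hi]

/-- Isolating the denominator leaves a numerator continuous at `t = 0`, where its sign is governed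
by `-B y z`. The form of `newNormal_eq` serves the same purpose. -/
theorem newDual_eq {i : ℕ} (hi : i ≠ x) (ht : 0 < t) (z : Homog) :
    newDual B y x t i z = -((1 + t) * -B y z - 2 * t * B i z) / (2 * t) := by
  rw [newDual_of_ne hi]; field_simp; ring

theorem newNormal_eq {F : Finset ℕ} (hx : x ∉ F) (hF : F.card = 4) (ht : 0 < t) (z : Homog) :
    newNormal B F y x t z = ((3 + 2 * t) * -B y z - t * ∑ i ∈ F, B i z) / t := by
  have : ∀ i ∈ F, newDual B y x t i z = B i z + (1 + t) / (2 * t) * B y z :=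
    fun i hi => newDual_of_ne (fun h : i = x => hx (h ▸ hi)) z
  rw [newNormal, LinearMap.sub_apply, LinearMap.sum_apply, Finset.sum_congr rfl this,
    newDual_self, Finset.sum_add_distrib, Finset.sum_const, hF, nsmul_eq_mul]
  push_cast
  field_simp
  ring

/-- The coefficient `(1 + t) / 2` in `apex` is what makes every old `h i`, `i ∈ F`, equal to `-1` at
the apex, so that these functionals need not change: the sum over `F` contributes `1 - 3 = -2`, and
`v y` contributes `-1`. -/
theorem IsFrame.new (hf : IsFrame v h T B) (hy : y ∈ T) (hx : x ∉ T) (ht : 0 < t) :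
    IsFrame (Function.update v x (apex v (T.erase y) y t))
      (Function.update h x (newNormal B (T.erase y) y x t)) (insert x (T.erase y))
      (newDual B y x t) := by
  have hF4 : (T.erase y).card = 4 := by rw [Finset.card_erase_of_mem hy, hf.card]
  have hxF : x ∉ T.erase y := fun h => hx (Finset.mem_of_mem_erase h)
  have hne : ∀ i ∈ T.erase y, i ≠ x := fun i hi h => hxF (h ▸ hi)
  have hmem : ∀ i ∈ T.erase y, i ∈ T := fun i hi => Finset.mem_of_mem_erase hi
  have hv : ∀ i ∈ T.erase y, Function.update v x (apex v (T.erase y) y t) i = v i :=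
    fun i hi => Function.update_of_ne (hne i hi) ..
  have hh : ∀ i ∈ T.erase y,
      Function.update h x (newNormal B (T.erase y) y x t) i = h i :=
    fun i hi => Function.update_of_ne (hne i hi) ..
  have hapex : ∀ f : Homog →ₗ[ℝ] ℝ, f (apex v (T.erase y) y t) =
      (1 + t) / 2 * ∑ i ∈ T.erase y, f (v i) - t * f (v y) := fun f => by
    rw [apex, map_sub, map_smul, map_smul, map_sum, smul_eq_mul, smul_eq_mul]
  have hByF : ∀ i ∈ T.erase y, B y (v i) = 0 := fun i hi => by
    rw [hf.dual y hy i (hmem i hi), if_neg (Finset.ne_of_mem_erase hi).symm]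
  have hByapex : B y (apex v (T.erase y) y t) = -t := by
    rw [hapex, Finset.sum_eq_zero hByF, hf.dual y hy y hy, if_pos rfl]; ring
  have hBapex : ∀ i ∈ T.erase y, B i (apex v (T.erase y) y t) = (1 + t) / 2 := fun i hi => by
    rw [hapex, Finset.sum_congr rfl fun j hj => hf.dual i (hmem i hi) j (hmem j hj),
      Finset.sum_ite_eq, if_pos hi, hf.dual i (hmem i hi) y hy,
      if_neg (Finset.ne_of_mem_erase hi)]
    ring
  have hdual : ∀ i ∈ insert x (T.erase y), ∀ j ∈ insert x (T.erase y),
      newDual B y x t i (Function.update v x (apex v (T.erase y) y t) j) =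
        if i = j then 1 else 0 := by
    intro i hi j hj
    rcases Finset.mem_insert.1 hi with rfl | hi' <;> rcases Finset.mem_insert.1 hj with rfl | hj'
    · rw [Function.update_self, newDual_self, hByapex, if_pos rfl]; field_simp
    · rw [hv j hj', newDual_self, hByF j hj', if_neg (hne j hj').symm]; ring
    · rw [Function.update_self, newDual_of_ne (hne i hi'), hBapex i hi', hByapex,
        if_neg (hne i hi')]
      field_simp; ring
    · rw [hv j hj', newDual_of_ne (hne i hi'), hByF j hj', hf.dual i (hmem i hi') j (hmem j hj')]
      ring
  refine ⟨?_, hdual, fun z => ?_, ?_⟩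
  · rw [Finset.card_insert_of_notMem hxF, hF4]
  · have hz := hf.expand z
    rw [← Finset.add_sum_erase T _ hy] at hz
    have hsum : ∑ i ∈ T.erase y,
        newDual B y x t i z • Function.update v x (apex v (T.erase y) y t) i =
        ∑ i ∈ T.erase y, B i z • v i + ((1 + t) / (2 * t) * B y z) • ∑ i ∈ T.erase y, v i := by
      rw [Finset.smul_sum, ← Finset.sum_add_distrib]
      exact Finset.sum_congr rfl fun i hi => by
        rw [hv i hi, newDual_of_ne (hne i hi), add_smul]
    rw [Finset.sum_insert hxF, Function.update_self, hsum, newDual_self, apex]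
    conv_rhs => rw [← hz]
    have e1 : -(t⁻¹ * B y z) * ((1 + t) / 2) = -((1 + t) / (2 * t) * B y z) := by field_simp
    have e2 : -(t⁻¹ * B y z) * t = -B y z := by field_simp
    rw [smul_sub, smul_smul, smul_smul, e1, e2]
    module
  · intro i hi j hj
    rcases Finset.mem_insert.1 hi with rfl | hi'
    · rw [Function.update_self, newNormal, LinearMap.sub_apply, LinearMap.sum_apply,
        hdual i hi j hj, Finset.sum_congr rfl fun k hk =>
          hdual k (Finset.mem_insert_of_mem hk) j hj, Finset.sum_ite_eq']
      rcases Finset.mem_insert.1 hj with rfl | hj'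
      · rw [if_pos rfl, if_neg hxF, if_pos rfl]; ring
      · rw [if_neg (hne j hj').symm, if_pos hj', if_neg (hne j hj').symm]; ring
    · rw [hh i hi']
      rcases Finset.mem_insert.1 hj with rfl | hj'
      · have hs : ∑ j ∈ T.erase y, h i (v j) = -2 := by
          have : ∀ j ∈ T.erase y, h i (v j) = (if i = j then 2 else 0) - 1 := fun j hj => by
            rw [hf.normal i (hmem i hi') j (hmem j hj)]; split_ifs <;> norm_num
          rw [Finset.sum_congr rfl this, Finset.sum_sub_distrib, Finset.sum_ite_eq, if_pos hi',
            Finset.sum_const, hF4]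
          norm_num
        rw [Function.update_self, hapex, hs, hf.normal i (hmem i hi') y hy,
          if_neg (Finset.ne_of_mem_erase hi'), if_neg (hne i hi')]
        ring
      · rw [hv j hj', hf.normal i (hmem i hi') j (hmem j hj')]

end NewFrame

/-! ### Realizations of rectified stacked spheres -/

/-- Vectors and functionals that define the cone over a rectification of the stacked sphere `K`
with `n + 5` vertices: the rays are the sums `v a + v b` for edges `{a, b}`, and the facets lie in
the hyperplanes `h i = 0` for vertices `i` and `g F = 0` for facets `F`. -/
structure Realization (n : ℕ) (K : Finset (Finset ℕ)) (v : ℕ → Homog)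
    (h : ℕ → Homog →ₗ[ℝ] ℝ) (g : Finset ℕ → Homog →ₗ[ℝ] ℝ) : Prop where
  h_eq : ∀ i < n + 5, ∀ e ∈ edges K, i ∈ e → h i (edgePoint v e) = 0
  h_lt : ∀ i < n + 5, ∀ e ∈ edges K, i ∉ e → h i (edgePoint v e) < 0
  g_eq : ∀ F ∈ K, ∀ e ∈ edges K, e ⊆ F → g F (edgePoint v e) = 0
  g_lt : ∀ F ∈ K, ∀ e ∈ edges K, ¬ e ⊆ F → g F (edgePoint v e) < 0
  pos : ∀ i < n + 5, 0 < (v i).2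
  h_center : ∀ i < n + 5, h i (0, 1) < 0
  g_center : ∀ F ∈ K, g F (0, 1) < 0
  frame : ∀ F ∈ K, ∃ (T : Finset ℕ) (y : ℕ) (B : ℕ → Homog →ₗ[ℝ] ℝ), y ∈ T ∧
    T ⊆ Finset.range (n + 5) ∧ F = T.erase y ∧ g F = -B y ∧ IsFrame v h T B
  gen : ∀ z, (∀ i < n + 5, h i z ≤ 0) → (∀ F ∈ K, g F z ≤ 0) →
    z ∈ PointedCone.hull ℝ (edgePoint v '' edges K)

/-- At `t = 0` the new point `apex + v a` is half the sum of the three edge points of `F` at `a`, so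
it lies in the interior of a triangle of the octahedron. -/
theorem sum_erase_add_eq {F : Finset ℕ} (hF : F.card = 4) {a : ℕ} (ha : a ∈ F)
    (v : ℕ → Homog) (f : Homog →ₗ[ℝ] ℝ) :
    1 / 2 * ∑ i ∈ F, f (v i) + f (v a) = 1 / 2 * ∑ b ∈ F.erase a, f (v a + v b) := by
  simp only [map_add]
  rw [Finset.sum_add_distrib, Finset.sum_const, Finset.card_erase_of_mem ha, hF,
    ← Finset.add_sum_erase F _ ha]
  simp only [nsmul_eq_mul]
  push_cast
  ring

theorem apply_apex (v : ℕ → Homog) (F : Finset ℕ) (y : ℕ) (t : ℝ) (f : Homog →ₗ[ℝ] ℝ) :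
    f (apex v F y t) = (1 + t) / 2 * ∑ i ∈ F, f (v i) - t * f (v y) := by
  rw [apex, map_sub, map_smul, map_smul, map_sum, smul_eq_mul, smul_eq_mul]

/-- A strict inequality that holds at `0` holds near `0`. -/
theorem eventually_neg_of_continuous {φ : ℝ → ℝ} (hφ : Continuous φ) (h0 : φ 0 < 0) :
    ∀ᶠ t in nhdsWithin (0 : ℝ) (Set.Ioi 0), φ t < 0 :=
  (hφ.continuousAt.eventually_lt continuousAt_const h0).filter_mono nhdsWithin_le_nhds

/-! ### Stacking close to a facet. -/

section Step

variable {n : ℕ} {K : Finset (Finset ℕ)} {v : ℕ → Homog} {h : ℕ → Homog →ₗ[ℝ] ℝ}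
  {g : Finset ℕ → Homog →ₗ[ℝ] ℝ} {T : Finset ℕ} {y : ℕ} {B : ℕ → Homog →ₗ[ℝ] ℝ}

/-- By `sum_erase_add_eq` the value at `t = 0` is half a sum of nonpositive terms, one of them
negative; continuity does the rest. -/
theorem eventually_apply_apex_add (hK : SphereLike n K) {F : Finset ℕ} (hF : F ∈ K) {a : ℕ}
    (ha : a ∈ F) (f : Homog →ₗ[ℝ] ℝ) (hle : ∀ e ∈ edges K, f (edgePoint v e) ≤ 0)
    (hlt : ∃ e ∈ edges K, e ⊆ F ∧ a ∈ e ∧ f (edgePoint v e) < 0) :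
    ∀ᶠ t in nhdsWithin (0 : ℝ) (Set.Ioi 0), f (apex v F y t + v a) < 0 := by
  apply eventually_neg_of_continuous
  · simp only [map_add, apply_apex]; fun_prop
  · have h1 := sum_erase_add_eq (hK.card_facet F hF) ha v f
    have h2 : ∑ b ∈ F.erase a, f (v a + v b) < 0 := by
      obtain ⟨e, he, heF, hae, hneg⟩ := hlt
      obtain ⟨c, hc, hca⟩ := Finset.exists_mem_ne
        (by rw [card_of_mem_edges he]; omega : 1 < e.card) a
      rw [eq_pair_of_mem (card_of_mem_edges he) hae hc hca.symm,
        edgePoint_pair v hca.symm] at hneg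
      refine Finset.sum_neg' (fun b hb => ?_) ⟨c, Finset.mem_erase.2 ⟨hca, heF hc⟩, hneg⟩
      rw [Finset.mem_erase] at hb
      rw [← edgePoint_pair v hb.1.symm]
      exact hle _ (pair_mem_edges hF ha hb.2 hb.1.symm)
    rw [map_add, apply_apex]
    linarith

/-- The inequalities that say that the new apex is close enough to the facet `T.erase y`. -/
structure CloseApex (n : ℕ) (K : Finset (Finset ℕ)) (v : ℕ → Homog) (h : ℕ → Homog →ₗ[ℝ] ℝ)
    (g : Finset ℕ → Homog →ₗ[ℝ] ℝ) (T : Finset ℕ) (y : ℕ) (B : ℕ → Homog →ₗ[ℝ] ℝ)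
    (t : ℝ) : Prop where
  pos : 0 < t
  h_lt : ∀ i < n + 5, i ∉ T.erase y → ∀ a ∈ T.erase y, h i (apex v (T.erase y) y t + v a) < 0
  g_lt : ∀ G ∈ K, G ≠ T.erase y → ∀ a ∈ T.erase y, g G (apex v (T.erase y) y t + v a) < 0
  dual_pos : ∀ z, (z = (0, 1) ∨ ∃ e ∈ edges K, ¬ e ⊆ T.erase y ∧ z = edgePoint v e) →
    ∀ a ∈ T.erase y, 0 < newDual B y (n + 5) t a z
  normal_neg : ∀ z, (z = (0, 1) ∨ ∃ e ∈ edges K, ¬ e ⊆ T.erase y ∧ z = edgePoint v e) →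
    newNormal B (T.erase y) y (n + 5) t z < 0
  height_pos : 0 < (apex v (T.erase y) y t).2

/-- These are finitely many strict inequalities. Each holds for small `t > 0` because, after
clearing positive denominators, it holds at `t = 0`. -/
theorem Realization.exists_closeApex (R : Realization n K v h g) (hK : SphereLike n K)
    (hF : T.erase y ∈ K) (hg : g (T.erase y) = -B y) : ∃ t, CloseApex n K v h g T y B t := by
  set F := T.erase y with hFdef
  have h4 := hK.card_facet F hF
  have hlt : ∀ a ∈ F, a < n + 5 := fun a ha => Finset.mem_range.1 (hK.facet_subset F hF ha)
  have hx : n + 5 ∉ F := hK.notMem_of_le hF le_rfl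
  have hhle : ∀ i < n + 5, ∀ e ∈ edges K, h i (edgePoint v e) ≤ 0 := fun i hi e he => by
    by_cases hie : i ∈ e
    · exact (R.h_eq i hi e he hie).le
    · exact (R.h_lt i hi e he hie).le
  have hgle : ∀ G ∈ K, ∀ e ∈ edges K, g G (edgePoint v e) ≤ 0 := fun G hG e he => by
    by_cases hie : e ⊆ G
    · exact (R.g_eq G hG e he hie).le
    · exact (R.g_lt G hG e he hie).le
  have e1 : ∀ᶠ t in nhdsWithin (0 : ℝ) (Set.Ioi 0), ∀ i ∈ Finset.range (n + 5), ∀ a ∈ F,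
      i ∉ F → h i (apex v F y t + v a) < 0 := by
    rw [Filter.eventually_all_finset]; intro i hi
    rw [Filter.eventually_all_finset]; intro a ha
    rw [Filter.eventually_imp_distrib_left]; intro hiF
    have hi' := Finset.mem_range.1 hi
    obtain ⟨b, hb, hba⟩ := Finset.exists_mem_ne (by omega : 1 < F.card) a
    have hab := pair_mem_edges hF ha hb hba.symm
    have hsub : ({a, b} : Finset ℕ) ⊆ F := by
      intro c hc
      simp only [Finset.mem_insert, Finset.mem_singleton] at hc
      rcases hc with rfl | rfl <;> assumption
    exact eventually_apply_apex_add hK hF ha (h i) (hhle i hi')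
      ⟨_, hab, hsub, by simp, R.h_lt i hi' _ hab fun h => hiF (hsub h)⟩
  have e2 : ∀ᶠ t in nhdsWithin (0 : ℝ) (Set.Ioi 0), ∀ G ∈ K, ∀ a ∈ F,
      G ≠ F → g G (apex v F y t + v a) < 0 := by
    rw [Filter.eventually_all_finset]; intro G hG
    rw [Filter.eventually_all_finset]; intro a ha
    rw [Filter.eventually_imp_distrib_left]; intro hGF
    obtain ⟨e, he, heF, hae, heG⟩ : ∃ e ∈ edges K, e ⊆ F ∧ a ∈ e ∧ ¬ e ⊆ G := by
      by_contra! hno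
      refine hGF (hK.eq_of_subset hF hG fun b hb => ?_).symm
      obtain ⟨c, hc, hca⟩ : ∃ c ∈ F, c ≠ a ∧ (b = a ∨ b = c) := by
        by_cases hba : b = a
        · obtain ⟨c, hc, hca⟩ := Finset.exists_mem_ne (by omega : 1 < F.card) a
          exact ⟨c, hc, hca, Or.inl hba⟩
        · exact ⟨b, hb, hba, Or.inr rfl⟩
      refine hno {a, c} (pair_mem_edges hF ha hc hca.1.symm) ?_ (by simp) ?_
      · intro d hd
        simp only [Finset.mem_insert, Finset.mem_singleton] at hd
        rcases hd with rfl | rfl <;> assumption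
      · simpa using hca.2
    exact eventually_apply_apex_add hK hF ha (g G) (hgle G hG)
      ⟨e, he, heF, hae, R.g_lt G hG e he heG⟩
  let Z : Finset Homog :=
    insert (0, 1) ((Finset.filter (fun e => ¬ e ⊆ F) (edges K)).image (edgePoint v))
  have hZ : ∀ z, z ∈ Z ↔ (z = (0, 1) ∨ ∃ e ∈ edges K, ¬ e ⊆ F ∧ z = edgePoint v e) := by
    intro z
    simp only [Z, Finset.mem_insert, Finset.mem_image, Finset.mem_filter, and_assoc]
    refine or_congr_right (exists_congr fun e => ?_)
    rw [eq_comm (a := z)]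
  -- The centre and the edge points not on the octahedron of `F` lie strictly on the inner side of
  -- its hyperplane.
  have hZneg : ∀ z ∈ Z, -B y z < 0 := by
    intro z hz
    rw [← LinearMap.neg_apply, ← hg]
    rcases (hZ z).1 hz with rfl | ⟨e, he, heF, rfl⟩
    · exact R.g_center F hF
    · exact R.g_lt F hF e he heF
  have e3 : ∀ᶠ t in nhdsWithin (0 : ℝ) (Set.Ioi 0), ∀ z ∈ Z, ∀ a ∈ F,
      (1 + t) * -B y z - 2 * t * B a z < 0 := by
    rw [Filter.eventually_all_finset]; intro z hz
    rw [Filter.eventually_all_finset]; intro a ha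
    exact eventually_neg_of_continuous (by fun_prop) (by simpa using hZneg z hz)
  have e4 : ∀ᶠ t in nhdsWithin (0 : ℝ) (Set.Ioi 0), ∀ z ∈ Z,
      (3 + 2 * t) * -B y z - t * ∑ i ∈ F, B i z < 0 := by
    rw [Filter.eventually_all_finset]; intro z hz
    exact eventually_neg_of_continuous (by fun_prop) (by have := hZneg z hz; linarith)
  have e5 : ∀ᶠ t in nhdsWithin (0 : ℝ) (Set.Ioi 0), -(apex v F y t).2 < 0 := by
    have hform : ∀ t, (apex v F y t).2 = (1 + t) / 2 * ∑ i ∈ F, (v i).2 - t * (v y).2 :=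
      fun t => apply_apex v F y t (LinearMap.snd ℝ _ _)
    simp only [hform]
    refine eventually_neg_of_continuous (by fun_prop) ?_
    have : 0 < ∑ i ∈ F, (v i).2 :=
      Finset.sum_pos (fun i hi => R.pos i (hlt i hi)) (Finset.card_pos.1 (by omega))
    linarith
  have e0 : ∀ᶠ t in nhdsWithin (0 : ℝ) (Set.Ioi 0), 0 < t := self_mem_nhdsWithin
  obtain ⟨t, ht, ht1, ht2, ht3, ht4, ht5⟩ :=
    (e0.and (e1.and (e2.and (e3.and (e4.and e5))))).exists
  refine ⟨t, ht, fun i hi hiF a ha => ht1 i (Finset.mem_range.2 hi) a ha hiF,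
    fun G hG hGF a ha => ht2 G hG a ha hGF, fun z hz a ha => ?_, fun z hz => ?_, by linarith⟩
  · rw [newDual_eq (fun h : a = n + 5 => hx (h ▸ ha)) ht]
    have := ht3 z ((hZ z).2 hz) a ha
    exact div_pos (by linarith) (by linarith)
  · rw [newNormal_eq hx h4 ht]
    exact div_neg_of_neg_of_pos (ht4 z ((hZ z).2 hz)) ht

/-- The facet functionals after stacking a vertex `x` onto `F`. -/
noncomputable def newFacetNormal (g : Finset ℕ → Homog →ₗ[ℝ] ℝ) (B : ℕ → Homog →ₗ[ℝ] ℝ)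
    (F : Finset ℕ) (y x : ℕ) (t : ℝ) (G : Finset ℕ) : Homog →ₗ[ℝ] ℝ :=
  if x ∈ G then -∑ a ∈ F \ G, newDual B y x t a else g G

theorem newFacetNormal_of_notMem {F G : Finset ℕ} {x : ℕ} {t : ℝ} (hG : x ∉ G) :
    newFacetNormal g B F y x t G = g G := if_neg hG

theorem newFacetNormal_insert {F : Finset ℕ} {x a : ℕ} {t : ℝ} (hx : x ∉ F) (ha : a ∈ F) :
    newFacetNormal g B F y x t (insert x (F.erase a)) = -newDual B y x t a := by
  have : F \ insert x (F.erase a) = {a} := by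
    ext b
    simp only [Finset.mem_sdiff, Finset.mem_insert, Finset.mem_erase, Finset.mem_singleton]
    constructor
    · tauto
    · rintro rfl
      exact ⟨ha, fun h => h.elim (fun h => hx (h ▸ ha)) fun h => h.1 rfl⟩
  rw [newFacetNormal, if_pos (Finset.mem_insert_self _ _), this, Finset.sum_singleton]

/-- Stacking a vertex onto a facet, sufficiently close to it. -/
theorem Realization.stack (R : Realization n K v h g) (hK : SphereLike n K) (hy : y ∈ T)
    (hT : T ⊆ Finset.range (n + 5)) (hF : T.erase y ∈ K) (hg : g (T.erase y) = -B y)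
    (hf : IsFrame v h T B) {t : ℝ} (C : CloseApex n K v h g T y B t) :
    Realization (n + 1) (Polytopes.stack K (T.erase y) (n + 5))
      (Function.update v (n + 5) (apex v (T.erase y) y t))
      (Function.update h (n + 5) (newNormal B (T.erase y) y (n + 5) t))
      (newFacetNormal g B (T.erase y) y (n + 5) t) := by
  have hxT : n + 5 ∉ T := fun h => by simpa using hT h
  have hf' := hf.new hy hxT C.pos
  have hedge := edges_stack hK hF
  set F := T.erase y with hFdef
  set x := n + 5 with hxdef
  set v' := Function.update v x (apex v F y t) with hv'
  set h' := Function.update h x (newNormal B F y x t) with hh'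
  set g' := newFacetNormal g B F y x t with hg'
  have hx : ∀ G ∈ K, x ∉ G := fun G hG => hK.notMem_of_le hG le_rfl
  have hvx : v' x = apex v F y t := Function.update_self ..
  have hhx : h' x = newNormal B F y x t := Function.update_self ..
  have hvne : ∀ i, i ≠ x → v' i = v i := fun i hi => Function.update_of_ne hi ..
  have hhne : ∀ i, i ≠ x → h' i = h i := fun i hi => Function.update_of_ne hi ..
  have hFlt : ∀ a ∈ F, a < x := fun a ha => Finset.mem_range.1 (hK.facet_subset F hF ha)
  have hxe : ∀ e ∈ edges K, x ∉ e := fun e he hxe => by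
    simpa [hxdef] using hK.edge_subset he hxe
  have hold : ∀ e ∈ edges K, edgePoint v' e = edgePoint v e := fun e he =>
    edgePoint_congr fun i hi => hvne i fun h => hxe e he (h ▸ hi)
  have hnew : ∀ a ∈ F, edgePoint v' {x, a} = apex v F y t + v a := fun a ha => by
    rw [edgePoint_pair v' (hFlt a ha).ne', hvx, hvne a (hFlt a ha).ne]
  have hpair : ∀ a ∈ F, ({x, a} : Finset ℕ) ⊆ insert x F := fun a ha b hb => by
    simp only [Finset.mem_insert, Finset.mem_singleton] at hb
    rcases hb with rfl | rfl <;> simp [ha]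
  -- On edges inside the new simplex the new functionals are computed by the frame; on the remaining
  -- old edges their signs come from `CloseApex`.
  have hcases : ∀ e ∈ edges (Polytopes.stack K F x),
      (e ⊆ insert x F ∧ e.card = 2 ∧ (e ∈ edges K ∧ e ⊆ F ∨ ∃ a ∈ F, e = {x, a})) ∨
      (e ∈ edges K ∧ ¬ e ⊆ F) := by
    intro e he
    rw [hedge, Finset.mem_union, Finset.mem_image] at he
    rcases he with he | ⟨a, ha, rfl⟩
    · by_cases heF : e ⊆ F
      · exact Or.inl ⟨heF.trans (Finset.subset_insert _ _), card_of_mem_edges he, Or.inl ⟨he, heF⟩⟩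
      · exact Or.inr ⟨he, heF⟩
    · exact Or.inl ⟨hpair a ha, Finset.card_pair (hFlt a ha).ne', Or.inr ⟨a, ha, rfl⟩⟩
  have hg'old : ∀ G ∈ K, g' G = g G := fun G hG => newFacetNormal_of_notMem (hx G hG)
  have hg'new : ∀ a ∈ F, g' (insert x (F.erase a)) = -newDual B y x t a :=
    fun a ha => newFacetNormal_insert (hx F hF) ha
  refine ⟨?_, ?_, ?_, ?_, ?_, ?_, ?_, ?_, ?_⟩
  · intro i hi e he hie
    rcases hcases e he with ⟨hsub, hc, -⟩ | ⟨he, heF⟩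
    · rw [hf'.normal_edgePoint (hsub hie) hsub hc, if_pos hie]
    · have hix : i ≠ x := fun h => hxe e he (h ▸ hie)
      rw [hhne i hix, hold e he]
      exact R.h_eq i (by omega) e he hie
  · intro i hi e he hie
    rcases hcases e he with ⟨hsub, hc, hor⟩ | ⟨he, heF⟩
    · by_cases hiT : i ∈ insert x F
      · rw [hf'.normal_edgePoint hiT hsub hc, if_neg hie]; norm_num
      · rw [Finset.mem_insert, not_or] at hiT
        rw [hhne i hiT.1]
        rcases hor with ⟨he, -⟩ | ⟨a, ha, rfl⟩
        · rw [hold e he]; exact R.h_lt i (by omega) e he hie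
        · rw [hnew a ha]; exact C.h_lt i (by omega) hiT.2 a ha
    · rw [hold e he]
      by_cases hix : i = x
      · rw [hix, hhx]; exact C.normal_neg _ (Or.inr ⟨e, he, heF, rfl⟩)
      · rw [hhne i hix]; exact R.h_lt i (by omega) e he hie
  · intro G hG e he heG
    rcases mem_stack.1 hG with ⟨hGF, hG⟩ | ⟨a, ha, rfl⟩
    · rw [hg'old G hG]
      rw [hedge, Finset.mem_union, Finset.mem_image] at he
      rcases he with he | ⟨b, hb, rfl⟩
      · rw [hold e he]; exact R.g_eq G hG e he heG
      · exact absurd (heG (by simp)) (hx G hG)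
    · have hsub : e ⊆ insert x F := heG.trans (Finset.insert_subset_insert _ (Finset.erase_subset _ _))
      have hae : a ∉ e := fun hae => by
        have := heG hae
        simp only [Finset.mem_insert, Finset.mem_erase, ne_eq, not_true_eq_false, false_and,
          or_false] at this
        exact hx F hF (this ▸ ha)
      rw [hg'new a ha, LinearMap.neg_apply,
        hf'.dual_edgePoint (Finset.mem_insert_of_mem ha) hsub, if_neg hae, neg_zero]
  · intro G hG e he heG
    rcases mem_stack.1 hG with ⟨hGF, hG⟩ | ⟨a, ha, rfl⟩
    · rw [hg'old G hG]
      rw [hedge, Finset.mem_union, Finset.mem_image] at he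
      rcases he with he | ⟨b, hb, rfl⟩
      · rw [hold e he]; exact R.g_lt G hG e he heG
      · rw [hnew b hb]; exact C.g_lt G hG hGF b hb
    · rw [hg'new a ha, LinearMap.neg_apply, neg_lt_zero]
      rcases hcases e he with ⟨hsub, hc, -⟩ | ⟨he, heF⟩
      · have hae : a ∈ e := by
          by_contra hae
          refine heG fun b hb => ?_
          have := hsub hb
          rw [Finset.mem_insert] at this ⊢
          exact this.imp_right fun hbF => Finset.mem_erase.2 ⟨fun h => hae (h ▸ hb), hbF⟩
        rw [hf'.dual_edgePoint (Finset.mem_insert_of_mem ha) hsub, if_pos hae]; norm_num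
      · rw [hold e he]; exact C.dual_pos _ (Or.inr ⟨e, he, heF, rfl⟩) a ha
  · intro i hi
    by_cases hix : i = x
    · rw [hix, hvx]; exact C.height_pos
    · rw [hvne i hix]; exact R.pos i (by omega)
  · intro i hi
    by_cases hix : i = x
    · rw [hix, hhx]; exact C.normal_neg _ (Or.inl rfl)
    · rw [hhne i hix]; exact R.h_center i (by omega)
  · intro G hG
    rcases mem_stack.1 hG with ⟨hGF, hG⟩ | ⟨a, ha, rfl⟩
    · rw [hg'old G hG]; exact R.g_center G hG
    · rw [hg'new a ha, LinearMap.neg_apply, neg_lt_zero]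
      exact C.dual_pos _ (Or.inl rfl) a ha
  · intro G hG
    rcases mem_stack.1 hG with ⟨hGF, hG⟩ | ⟨a, ha, rfl⟩
    · obtain ⟨T₀, y₀, B₀, hy₀, hT₀, rfl, hg₀, hf₀⟩ := R.frame G hG
      have hne : ∀ i ∈ T₀, i ≠ x := fun i hi => (Finset.mem_range.1 (hT₀ hi)).ne
      exact ⟨T₀, y₀, B₀, hy₀, hT₀.trans (Finset.range_subset_range.2 (by omega)), rfl,
        by rw [hg'old _ hG, hg₀],
        hf₀.congr (fun i hi => hvne i (hne i hi)) fun i hi => hhne i (hne i hi)⟩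
    · refine ⟨insert x F, a, newDual B y x t, Finset.mem_insert_of_mem ha, ?_, ?_, hg'new a ha, hf'⟩
      · intro b hb
        rcases Finset.mem_insert.1 hb with rfl | hb
        · exact Finset.mem_range.2 (by omega)
        · exact Finset.mem_range.2 (by have := hFlt b hb; omega)
      · rw [Finset.erase_insert_of_ne (hFlt a ha).ne']
  · intro z hz1 hz2
    -- The hyperplane of `F` cuts the new cone in two: the inner part lies in the old cone, the
    -- outer part in the cone over the hypersimplex of the new frame.
    by_cases hzF : g F z ≤ 0
    · have hmem := R.gen z (fun i hi => by
        have := hz1 i (by omega); rwa [hhne i (by omega)] at this) fun G hG => by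
          by_cases hGF : G = F
          · rw [hGF]; exact hzF
          · have := hz2 G (mem_stack.2 (Or.inl ⟨hGF, hG⟩))
            rwa [hg'old G hG] at this
      refine Submodule.span_mono ?_ hmem
      rintro _ ⟨e, he, rfl⟩
      exact ⟨e, by rw [hedge]; exact Finset.mem_coe.2 (Finset.mem_union_left _ he), hold e he⟩
    · rw [not_le, hg, LinearMap.neg_apply] at hzF
      refine hf'.mem_cone _ (fun i hi j hj hij => ?_) (fun i hi => ?_) fun i hi => ?_
      · rw [← edgePoint_pair v' hij]
        refine PointedCone.subset_hull ⟨_, ?_, rfl⟩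
        rw [Finset.mem_coe, hedge, Finset.mem_union, Finset.mem_image]
        rcases Finset.mem_insert.1 hi with rfl | hi' <;>
          rcases Finset.mem_insert.1 hj with rfl | hj'
        · exact absurd rfl hij
        · exact Or.inr ⟨j, hj', rfl⟩
        · exact Or.inr ⟨i, hi', Finset.pair_comm _ _⟩
        · exact Or.inl (pair_mem_edges hF hi' hj' hij)
      · rcases Finset.mem_insert.1 hi with rfl | hi'
        · rw [newDual_self, neg_nonneg, ← neg_nonneg, ← mul_neg]
          exact mul_nonneg (inv_nonneg.2 C.pos.le) hzF.le
        · have := hz2 _ (mem_stack.2 (Or.inr ⟨i, hi', rfl⟩))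
          rw [hg'new i hi', LinearMap.neg_apply] at this
          linarith
      · refine hz1 i ?_
        rcases Finset.mem_insert.1 hi with rfl | hi'
        · omega
        · have := hFlt i hi'; omega

end Step

/-! ### The hypersimplex -/

/-- The vertices of a four-simplex around the origin, in homogeneous coordinates. -/
noncomputable def simplexVertex (i : ℕ) : Homog :=
  if h : i < 4 then (EuclideanSpace.single ⟨i, h⟩ 1, 1) else
    (-∑ j : Fin 4, EuclideanSpace.single j 1, 1)

/-- The barycentric coordinates of this simplex. -/
noncomputable def simplexDual (i : ℕ) : Homog →ₗ[ℝ] ℝ :=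
  (5 : ℝ)⁻¹ • (LinearMap.snd ℝ _ _ -
      ∑ j : Fin 4, (EuclideanSpace.proj (𝕜 := ℝ) j).toLinearMap ∘ₗ LinearMap.fst ℝ _ _) +
    if h : i < 4 then (EuclideanSpace.proj (𝕜 := ℝ) (⟨i, h⟩ : Fin 4)).toLinearMap ∘ₗ
      LinearMap.fst ℝ _ _ else 0

noncomputable def simplexNormal (i : ℕ) : Homog →ₗ[ℝ] ℝ :=
  (2 : ℝ) • simplexDual i - ∑ j ∈ Finset.range 5, simplexDual j

theorem simplexDual_simplexVertex {i j : ℕ} (hi : i ∈ Finset.range 5) (hj : j ∈ Finset.range 5) :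
    simplexDual i (simplexVertex j) = if i = j then 1 else 0 := by
  rw [Finset.mem_range] at hi hj
  interval_cases i <;> interval_cases j <;>
    simp [simplexDual, simplexVertex, Fin.sum_univ_four] <;> norm_num

theorem isFrame_simplex :
    IsFrame simplexVertex simplexNormal (Finset.range 5) simplexDual where
  card := by simp
  dual i hi j hj := simplexDual_simplexVertex hi hj
  expand z := by
    obtain ⟨z, s⟩ := z
    apply Prod.ext
    · ext k
      simp only [Finset.sum_range_succ, Finset.sum_range_zero]
      fin_cases k <;> simp [simplexDual, simplexVertex, Fin.sum_univ_four]
    · simp only [Finset.sum_range_succ, Finset.sum_range_zero]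
      simp [simplexDual, simplexVertex, Fin.sum_univ_four]
      ring
  normal i hi j hj := by
    rw [simplexNormal, LinearMap.sub_apply, LinearMap.smul_apply, LinearMap.sum_apply,
      simplexDual_simplexVertex hi hj,
      Finset.sum_congr rfl fun k hk => simplexDual_simplexVertex hk hj, Finset.sum_ite_eq',
      if_pos hj]
    split_ifs <;> norm_num

theorem simplexDual_center (i : ℕ) : simplexDual i (0, 1) = 5⁻¹ := by
  simp only [simplexDual]
  split_ifs <;> simp

/-- The base case is the hypersimplex with ten vertices; a single frame serves all five facets. -/
theorem realization_simplex :
    Realization 0 (Finset.powersetCard 4 (Finset.range 5)) simplexVertex simplexNormal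
      fun F => -∑ a ∈ Finset.range 5 \ F, simplexDual a := by
  have hf := isFrame_simplex
  have hsub : ∀ e ∈ edges (Finset.powersetCard 4 (Finset.range 5)), e ⊆ Finset.range 5 :=
    fun e he => sphereLike_simplex.edge_subset he
  have hF : ∀ F ∈ Finset.powersetCard 4 (Finset.range 5), ∃ y ∈ Finset.range 5,
      F = (Finset.range 5).erase y ∧ Finset.range 5 \ F = {y} := by
    intro F hF
    rw [Finset.mem_powersetCard] at hF
    have hc : (Finset.range 5 \ F).card = 1 := by
      rw [Finset.card_sdiff_of_subset hF.1, hF.2]; rfl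
    obtain ⟨y, hy⟩ := Finset.card_eq_one.1 hc
    have hy' : y ∈ Finset.range 5 \ F := by rw [hy]; simp
    exact ⟨y, (Finset.mem_sdiff.1 hy').1,
      by rw [Finset.erase_eq, ← hy, Finset.sdiff_sdiff_eq_self hF.1], hy⟩
  refine ⟨?_, ?_, ?_, ?_, ?_, ?_, ?_, ?_, ?_⟩
  · intro i hi e he hie
    rw [hf.normal_edgePoint (Finset.mem_range.2 hi) (hsub e he) (card_of_mem_edges he), if_pos hie]
  · intro i hi e he hie
    rw [hf.normal_edgePoint (Finset.mem_range.2 hi) (hsub e he) (card_of_mem_edges he), if_neg hie]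
    norm_num
  · intro F hFK e he heF
    obtain ⟨y, hy, rfl, hsd⟩ := hF F hFK
    rw [hsd, Finset.sum_singleton, LinearMap.neg_apply, hf.dual_edgePoint hy (hsub e he),
      if_neg fun h => Finset.notMem_erase _ _ (heF h), neg_zero]
  · intro F hFK e he heF
    obtain ⟨y, hy, rfl, hsd⟩ := hF F hFK
    rw [hsd, Finset.sum_singleton, LinearMap.neg_apply, hf.dual_edgePoint hy (hsub e he), if_pos]
    · norm_num
    · by_contra hye
      exact heF fun b hb => Finset.mem_erase.2 ⟨fun h => hye (h ▸ hb), hsub e he hb⟩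
  · intro i _
    unfold simplexVertex
    split_ifs <;> norm_num
  · intro i _
    simp only [simplexNormal, LinearMap.sub_apply, LinearMap.smul_apply, LinearMap.sum_apply,
      simplexDual_center]
    norm_num
  · intro F hFK
    obtain ⟨y, hy, rfl, hsd⟩ := hF F hFK
    rw [hsd, Finset.sum_singleton, LinearMap.neg_apply, simplexDual_center]
    norm_num
  · intro F hFK
    obtain ⟨y, hy, rfl, hsd⟩ := hF F hFK
    exact ⟨Finset.range 5, y, simplexDual, hy, subset_rfl, rfl, by rw [hsd, Finset.sum_singleton],
      hf⟩
  · intro z hz1 hz2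
    refine hf.mem_cone _ (fun i hi j hj hij => ?_) (fun i hi => ?_)
      fun i hi => hz1 i (Finset.mem_range.1 hi)
    · rw [← edgePoint_pair _ hij]
      refine PointedCone.subset_hull ⟨_, ?_, rfl⟩
      have hc : ({i, j} : Finset ℕ).card = 2 := Finset.card_pair hij
      have hs : ({i, j} : Finset ℕ) ⊆ Finset.range 5 := by
        intro k hk
        simp only [Finset.mem_insert, Finset.mem_singleton] at hk
        rcases hk with rfl | rfl <;> assumption
      obtain ⟨F, hF1, hF2, hF3⟩ := Finset.exists_subsuperset_card_eq hs
        (by omega : ({i, j} : Finset ℕ).card ≤ 4) (by simp)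
      exact mem_edges.2 ⟨F, Finset.mem_powersetCard.2 ⟨hF2, hF3⟩, hF1, hc⟩
    · have hmem : (Finset.range 5).erase i ∈ Finset.powersetCard 4 (Finset.range 5) :=
        Finset.mem_powersetCard.2 ⟨Finset.erase_subset _ _, by
          rw [Finset.card_erase_of_mem hi]; rfl⟩
      have := hz2 _ hmem
      have hsd : Finset.range 5 \ (Finset.range 5).erase i = {i} := by
        rw [Finset.sdiff_erase_self hi]
      rw [hsd, Finset.sum_singleton, LinearMap.neg_apply] at this
      linarith

/-- Every stacked sphere has a realization. -/
theorem exists_realization {n : ℕ} {K : Finset (Finset ℕ)} (hK : K ∈ stackedSpheres n) :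
    ∃ v h g, Realization n K v h g := by
  induction n generalizing K with
  | zero =>
    rw [stackedSpheres, Finset.mem_singleton] at hK
    exact hK ▸ ⟨_, _, _, realization_simplex⟩
  | succ n ih =>
    obtain ⟨L, hL, F, hF, rfl⟩ := mem_stackedSpheres_succ.1 hK
    obtain ⟨v, h, g, R⟩ := ih hL
    obtain ⟨T, y, B, hy, hT, rfl, hg, hf⟩ := R.frame F hF
    have hS := sphereLike_of_mem hL
    obtain ⟨t, C⟩ := R.exists_closeApex hS hF hg
    exact ⟨_, _, _, R.stack hS hy hT hF hg hf C⟩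

/-! ### The polytopes -/

/-- The vector `a` such that `⟪a, x⟫ ≤ 1` is the inequality `f (x, 1) ≤ 0`. -/
noncomputable def dehomogenize (f : Homog →ₗ[ℝ] ℝ) : EuclideanSpace ℝ (Fin 4) :=
  (InnerProductSpace.toDual ℝ _).symm
    (LinearMap.toContinuousLinearMap ((-(f (0, 1))⁻¹) • f ∘ₗ LinearMap.inl ℝ _ _))

theorem inner_dehomogenize {f : Homog →ₗ[ℝ] ℝ} (hf : f (0, 1) < 0) (x : EuclideanSpace ℝ (Fin 4)) :
    inner ℝ (dehomogenize f) x = 1 - f (x, 1) / f (0, 1) := by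
  have e : f (x, 1) = f (x, 0) + f (0, 1) := by rw [← map_add]; simp
  rw [dehomogenize, InnerProductSpace.toDual_symm_apply, e]
  have hne := hf.ne
  simp
  field_simp
  ring

theorem inner_dehomogenize_le_iff {f : Homog →ₗ[ℝ] ℝ} (hf : f (0, 1) < 0)
    (x : EuclideanSpace ℝ (Fin 4)) : inner ℝ (dehomogenize f) x ≤ 1 ↔ f (x, 1) ≤ 0 := by
  rw [inner_dehomogenize hf, sub_le_self_iff, div_nonneg_iff]
  constructor
  · rintro (⟨-, h⟩ | ⟨h, -⟩)
    · exact absurd hf h.not_gt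
    · exact h
  · exact fun h => Or.inr ⟨h, hf.le⟩

theorem inner_dehomogenize_eq_iff {f : Homog →ₗ[ℝ] ℝ} (hf : f (0, 1) < 0)
    (x : EuclideanSpace ℝ (Fin 4)) : inner ℝ (dehomogenize f) x = 1 ↔ f (x, 1) = 0 := by
  rw [inner_dehomogenize hf, sub_eq_self, div_eq_zero_iff, or_iff_left hf.ne]

/-- The points in Euclidean space of a realization. -/
noncomputable def affinePoint (v : ℕ → Homog) {K : Finset (Finset ℕ)} (e : {e // e ∈ edges K}) :
    EuclideanSpace ℝ (Fin 4) := (edgePoint v e.1).2⁻¹ • (edgePoint v e.1).1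

/-- The inequalities in Euclidean space of a realization. -/
noncomputable def facetVector (h : ℕ → Homog →ₗ[ℝ] ℝ) (g : Finset ℕ → Homog →ₗ[ℝ] ℝ) {n : ℕ}
    {K : Finset (Finset ℕ)} : Fin (n + 5) ⊕ {F // F ∈ K} → EuclideanSpace ℝ (Fin 4)
  | .inl i => dehomogenize (h i)
  | .inr F => dehomogenize (g F)

section

variable {n : ℕ} {K : Finset (Finset ℕ)} {v : ℕ → Homog} {h : ℕ → Homog →ₗ[ℝ] ℝ}
  {g : Finset ℕ → Homog →ₗ[ℝ] ℝ}

theorem Realization.edgePoint_pos (R : Realization n K v h g) (hK : SphereLike n K) {e : Finset ℕ}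
    (he : e ∈ edges K) : 0 < (edgePoint v e).2 := by
  rw [edgePoint, Prod.snd_sum]
  exact Finset.sum_pos (fun i hi => R.pos i (Finset.mem_range.1 (hK.edge_subset he hi)))
    (Finset.card_pos.1 (by rw [card_of_mem_edges he]; norm_num))

theorem Realization.affinePoint_one (R : Realization n K v h g) (hK : SphereLike n K)
    (e : {e // e ∈ edges K}) :
    (affinePoint v e, (1 : ℝ)) = (edgePoint v e.1).2⁻¹ • edgePoint v e.1 := by
  have := (R.edgePoint_pos hK e.2).ne'
  refine Prod.ext rfl ?_
  rw [Prod.smul_snd, smul_eq_mul, inv_mul_cancel₀ this]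

theorem Realization.inner_eq_one_iff (R : Realization n K v h g) (hK : SphereLike n K)
    (e : {e // e ∈ edges K}) (k : Fin (n + 5) ⊕ {F // F ∈ K}) :
    inner ℝ (facetVector h g k) (affinePoint v e) = (1 : ℝ) ↔ Incident e k := by
  have hne : (edgePoint v e.1).2⁻¹ ≠ 0 := inv_ne_zero (R.edgePoint_pos hK e.2).ne'
  rcases k with i | F
  · change inner ℝ (dehomogenize (h i)) _ = (1 : ℝ) ↔ i.1 ∈ e.1
    rw [inner_dehomogenize_eq_iff (R.h_center i i.2), R.affinePoint_one hK, map_smul, smul_eq_mul,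
      mul_eq_zero, or_iff_right hne]
    refine ⟨fun h0 => ?_, R.h_eq i i.2 e.1 e.2⟩
    by_contra hie
    exact (R.h_lt i i.2 e.1 e.2 hie).ne h0
  · change inner ℝ (dehomogenize (g F)) _ = (1 : ℝ) ↔ e.1 ⊆ F.1
    rw [inner_dehomogenize_eq_iff (R.g_center F F.2), R.affinePoint_one hK, map_smul, smul_eq_mul,
      mul_eq_zero, or_iff_right hne]
    refine ⟨fun h0 => ?_, R.g_eq F F.2 e.1 e.2⟩
    by_contra hie
    exact (R.g_lt F F.2 e.1 e.2 hie).ne h0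

/-- The rectified stacked polytope of a realization. -/
def Realization.polytope (_ : Realization n K v h g) : Set (EuclideanSpace ℝ (Fin 4)) :=
  convexHull ℝ (Set.range (affinePoint v (K := K)))

/-- The points satisfy the inequalities by the sign conditions of `R`. Conversely `gen` puts a
solution, lifted to height one, into the cone of the edge points, and the slice of that cone at
height one is the hull. -/
theorem Realization.doubleDescription (R : Realization n K v h g) (hK : SphereLike n K) :
    DoubleDescription R.polytope (affinePoint v (K := K)) (facetVector h g (n := n) (K := K)) := by
  have hle : ∀ (e : {e // e ∈ edges K}) (k : Fin (n + 5) ⊕ {F // F ∈ K}),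
      inner ℝ (facetVector h g k) (affinePoint v e) ≤ (1 : ℝ) := by
    intro e k
    by_cases hek : Incident e k
    · exact ((R.inner_eq_one_iff hK e k).2 hek).le
    have hpos : 0 < (edgePoint v e.1).2⁻¹ := inv_pos.2 (R.edgePoint_pos hK e.2)
    rcases k with i | F
    · change inner ℝ (dehomogenize (h i)) _ ≤ (1 : ℝ)
      rw [inner_dehomogenize_le_iff (R.h_center i i.2), R.affinePoint_one hK, map_smul, smul_eq_mul]
      exact (mul_neg_of_pos_of_neg hpos (R.h_lt i i.2 e.1 e.2 hek)).le
    · change inner ℝ (dehomogenize (g F)) _ ≤ (1 : ℝ)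
      rw [inner_dehomogenize_le_iff (R.g_center F F.2), R.affinePoint_one hK, map_smul, smul_eq_mul]
      exact (mul_neg_of_pos_of_neg hpos (R.g_lt F F.2 e.1 e.2 hek)).le
  refine ⟨rfl, Set.Subset.antisymm ?_ ?_⟩
  · refine convexHull_min (by rintro _ ⟨e, rfl⟩; exact hle e) ?_
    rw [Set.ofPred_forall]
    exact convex_iInter fun k => convex_halfSpace_le (f := fun x => inner ℝ (facetVector h g k) x)
      ⟨fun _ _ => inner_add_right _ _ _, fun _ _ => inner_smul_right _ _ _⟩ 1
  · intro x hx
    have hx : ∀ k : Fin (n + 5) ⊕ {F // F ∈ K}, inner ℝ (facetVector h g k) x ≤ (1 : ℝ) := hx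
    have hmem := R.gen (x, 1)
      (fun i hi => (inner_dehomogenize_le_iff (R.h_center i hi) x).1 (hx (.inl ⟨i, hi⟩)))
      (fun F hF => (inner_dehomogenize_le_iff (R.g_center F hF) x).1 (hx (.inr ⟨F, hF⟩)))
    have key : ∀ z ∈ PointedCone.hull ℝ (edgePoint v '' edges K),
        z = 0 ∨ 0 < z.2 ∧ z.2⁻¹ • z.1 ∈ R.polytope := by
      intro z hz
      induction hz using Submodule.span_induction with
      | mem z hz =>
        obtain ⟨e, he, rfl⟩ := hz
        exact Or.inr ⟨R.edgePoint_pos hK he, subset_convexHull ℝ _ ⟨⟨e, he⟩, rfl⟩⟩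
      | zero => exact Or.inl rfl
      | add z w _ _ hz hw =>
        rcases hz with rfl | ⟨hz, hz'⟩
        · rwa [zero_add]
        rcases hw with rfl | ⟨hw, hw'⟩
        · rw [add_zero]; exact Or.inr ⟨hz, hz'⟩
        have hzw : 0 < z.2 + w.2 := add_pos hz hw
        refine Or.inr ⟨hzw, ?_⟩
        have := (convex_convexHull ℝ (Set.range (affinePoint v (K := K)))) hz' hw'
          (a := z.2 / (z.2 + w.2)) (b := w.2 / (z.2 + w.2)) (by positivity) (by positivity)
          (by field_simp)
        have e1 : z.2 / (z.2 + w.2) * z.2⁻¹ = (z.2 + w.2)⁻¹ := by field_simp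
        have e2 : w.2 / (z.2 + w.2) * w.2⁻¹ = (z.2 + w.2)⁻¹ := by field_simp
        rw [smul_smul, smul_smul, e1, e2, ← smul_add] at this
        exact this
      | smul r z _ hz =>
        rcases hz with rfl | ⟨hz, hz'⟩
        · exact Or.inl (smul_zero r)
        obtain ⟨r, hr⟩ := r
        rcases hr.eq_or_lt with rfl | hr'
        · exact Or.inl (zero_smul ℝ z)
        · right
          change 0 < r * z.2 ∧ (r * z.2)⁻¹ • (r • z.1) ∈ R.polytope
          have e : (r * z.2)⁻¹ * r = z.2⁻¹ := by field_simp
          exact ⟨mul_pos hr' hz, by rwa [smul_smul, e]⟩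
    rcases key _ hmem with h0 | ⟨-, h1⟩
    · exact absurd (congrArg Prod.snd h0) one_ne_zero
    · simpa using h1

theorem Realization.irredundant (R : Realization n K v h g) (hK : SphereLike n K) :
    DoubleDescription.Irredundant (affinePoint v (K := K))
      (facetVector h g (n := n) (K := K)) where
  points e e' hee := by
    simp only [R.inner_eq_one_iff hK] at hee
    exact eq_of_forall_incident hK hee
  facets k k' hkk := by
    simp only [R.inner_eq_one_iff hK] at hkk
    exact hK.eq_of_forall_incident hkk
  exists_point k := by
    obtain ⟨e, he⟩ := hK.exists_incident k
    exact ⟨e, (R.inner_eq_one_iff hK e k).2 he⟩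

theorem Realization.polytope_mem (R : Realization n K v h g) (hK : SphereLike n K) :
    IsPolytope R.polytope ∧ IsTwoSimple R.polytope ∧ IsTwoSimplicial R.polytope ∧
      (R.polytope.extremePoints ℝ).encard = (10 + 4 * n : ℕ) := by
  have D := R.doubleDescription hK
  have I := R.irredundant hK
  refine ⟨D.isPolytope, D.isTwoSimple le_rfl fun e e' hee => ?_,
    D.isTwoSimplicial le_rfl fun k k' hkk => ?_, ?_⟩
  · simp only [R.inner_eq_one_iff hK]
    exact hK.ncard_vertex_inter_le e e' hee
  · simp only [R.inner_eq_one_iff hK]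
    exact hK.ncard_facet_inter_le k k' hkk
  · rw [D.extremePoints_eq I.points, ← Set.image_univ,
      (DoubleDescription.injective_point I.points).encard_image, Set.encard_univ,
      ENat.card_eq_coe_fintype_card, Fintype.card_coe, hK.card_edges]

end

/-! ### Counting combinatorial types. -/

theorem exists_polytope {n : ℕ} (K : stackedSpheres n) :
    ∃ (P : TwoSTwoSPolytope (10 + 4 * n)) (v : ℕ → Homog) (h : ℕ → Homog →ₗ[ℝ] ℝ)
      (g : Finset ℕ → Homog →ₗ[ℝ] ℝ) (R : Realization n K.1 v h g), P.1 = R.polytope := by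
  obtain ⟨v, h, g, R⟩ := exists_realization K.2
  exact ⟨⟨R.polytope, R.polytope_mem (sphereLike_of_mem K.2)⟩, v, h, g, R, rfl⟩

/-- There are at least as many combinatorial types as labelled stacked spheres, up to the number
of labellings. -/
theorem card_stackedSpheres_le (n : ℕ) : (stackedSpheres n).card ≤
    Nat.card (CombinatorialType (10 + 4 * n)) * (n + 5).factorial := by
  have := finite_combinatorialType (10 + 4 * n)
  have := Fintype.ofFinite (CombinatorialType (10 + 4 * n))
  classical
  choose P v h g R hP using @exists_polytope n
  let Φ : stackedSpheres n → CombinatorialType (10 + 4 * n) := fun K => Quotient.mk _ (P K)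
  -- All spheres of one type are images of a fixed one under permutations of the `n + 5` labels.
  have hfiber : ∀ c ∈ (Finset.univ : Finset (CombinatorialType (10 + 4 * n))),
      (Finset.univ.filter fun K => Φ K = c).card ≤ (n + 5).factorial := by
    intro c _
    rcases (Finset.univ.filter fun K => Φ K = c).eq_empty_or_nonempty with h0 | ⟨K, hKc⟩
    · rw [h0]; simp
    have hKc : Φ K = c := (Finset.mem_filter.1 hKc).2
    have hK := sphereLike_of_mem K.2
    calc (Finset.univ.filter fun K => Φ K = c).card
        = ((Finset.univ.filter fun K => Φ K = c).image Subtype.val).card :=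
          (Finset.card_image_of_injective _ Subtype.val_injective).symm
      _ ≤ ((Finset.univ : Finset (Equiv.Perm (Fin (n + 5)))).image
            fun π => K.1.image (Finset.image (relabel π))).card := by
          refine Finset.card_le_card fun L hL => ?_
          obtain ⟨L, hLc, rfl⟩ := Finset.mem_image.1 hL
          have hLc : Φ L = c := (Finset.mem_filter.1 hLc).2
          have hL := sphereLike_of_mem L.2
          obtain ⟨e⟩ : Nonempty (FaceLattice (P K).1 ≃o FaceLattice (P L).1) :=
            Quotient.exact (hKc.trans hLc.symm)
          rw [hP K, hP L] at e
          obtain ⟨φ, ψ, hinc⟩ := ((R K).doubleDescription hK).exists_incidence_equiv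
            ((R K).irredundant hK) ((R L).doubleDescription hL) ((R L).irredundant hL) e
          simp only [(R K).inner_eq_one_iff hK, (R L).inner_eq_one_iff hL] at hinc
          obtain ⟨π, hπ⟩ := exists_relabel_of_incidence_equiv hK hL φ ψ hinc
          exact Finset.mem_image.2 ⟨π, Finset.mem_univ _, hπ⟩
      _ ≤ (n + 5).factorial := by
          refine Finset.card_image_le.trans ?_
          rw [Finset.card_univ, Fintype.card_perm, Fintype.card_fin]
  have := Finset.card_le_mul_card_image_of_maps_to
    (s := (Finset.univ : Finset (stackedSpheres n))) (t := Finset.univ) (f := Φ)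
    (fun _ _ => Finset.mem_univ _) _ hfiber
  rwa [Finset.card_univ, Fintype.card_coe, Finset.card_univ, ← Nat.card_eq_fintype_card,
    mul_comm] at this

end Polytopes

theorem mainTheorem7 :
    (∀ n : ℕ, Finite (Polytopes.CombinatorialType (10 + 4 * n))) ∧
      ∃ C c : ℝ, 0 < C ∧ 1 < c ∧
        ∀ n : ℕ, C * c ^ n ≤ (Nat.card (Polytopes.CombinatorialType (10 + 4 * n)) : ℝ) := by
  refine ⟨fun n => Polytopes.finite_combinatorialType _, 1 / 1000, 3 / 2, by norm_num, by norm_num,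
    fun n => ?_⟩
  have h1 := Polytopes.pow_mul_factorial_le_card_stackedSpheres n
  have h2 : ((Polytopes.stackedSpheres n).card : ℝ) ≤
      Nat.card (Polytopes.CombinatorialType (10 + 4 * n)) * (n + 5).factorial := by
    exact_mod_cast Polytopes.card_stackedSpheres_le n
  exact le_of_mul_le_mul_right (h1.trans h2) (by exact_mod_cast (n + 5).factorial_pos)
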